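/- Let $\mathcal G$ be a connected closed (vacuum) bipartite $5$-colored graph with a finite number $\mathcal N$ of nodes: every node is white or black, every line joins a white and a black node and has a color in $\{1,\dots,5\}$, and exactly one line of each color meets every node. A face of color $(ij)$ is a connected component of the subgraph of lines of colors $i$ and $j$. For a cycle $\sigma$ on the five colors, taken up to inversion, the jacket $J=(\sigma,\sigma^{-1})$ is the closed surface made of the nodes and lines of $\mathcal G$ and of its faces of colors $(\sigma(\ell)\,\sigma(\ell+1))$; its genus $g_J$ is given by $2-2g_J=\chi_J$, its Euler characteristic. There are $12$ jackets, and the degree of $\mathcal G$ is $\omega(\mathcal G)=\sum_J g_J$. For $\alpha>0$ let $K_\alpha=\sum_{j\in\mathbb N/2}(2j+1)e^{-\alpha j(j+1)}\chi_j$ be the heat kernel of $\mathrm{SU}(2)$ and $\delta_\alpha(g^+,g^-)=K_\alpha(g^+)K_\alpha(g^-)$ on $\mathrm{SU}(2)\times\mathrm{SU}(2)$. Fix a subgroup $Z$ of the centre $\{\pm1\}\times\{\pm1\}$ and consider the colored Ooguri model on $(\mathrm{SU}(2)\times\mathrm{SU}(2))/Z$ (so $\mathrm{SO}(3)\times\mathrm{SO}(3)$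 if $Z$ is the whole centre), whose fields are seen as $Z$-invariant functions on $\mathrm{SU}(2)\times\mathrm{SU}(2)$; $\delta_\alpha$ then acts through its average over $Z$, $\delta^Z_\alpha(g)=\frac1{|Z|}\sum_{z\in Z}\delta_\alpha(zg)$. In edge variables its regularized amplitude is $$\mathcal A^\alpha_{\mathcal G}=\int\prod_{\text{lines }\tau}\ \prod_{i\ne\ell(\tau)}\mathrm dg^\tau_i\ \prod_{\text{nodes}}\ \frac1{[\delta_\alpha(1)]^4}\prod_{\{i,j,k\}\subset\{1,\dots,5\}}\delta^Z_\alpha(H_{ijk}),\qquad H_{ijk}=G^i_{jk}G^k_{ij}G^j_{ki},$$ where $\mathrm dg$ is the normalized Haar measure of $\mathrm{SU}(2)\times\mathrm{SU}(2)$, $\ell(\tau)$ is the color of $\tau$, the second product runs over the ten triples of colors, and $G^\ell_{ij}=(g^\tau_i)^{-1}g^\tau_j$ for the line $\tau$ of color $\ell$ at the node (these are the edge variables that satisfy the closure constraints of the propagator). The rescaling $\lambda\to\lambda/\delta_\alpha(1)^{3/2}$ of the coupling constant multiplies $\mathcal A^\alpha_{\mathcal G}$ by $\delta_\alpha(1)^{-3\mathcal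 N/2}$. The divergence degree $\gamma_{\mathcal G}\in[-\infty,+\infty]$ is the infimum of the real $\gamma$ for which $\delta_\alpha(1)^{-\gamma}$ times the rescaled amplitude has a finite limit as $\alpha\to0^+$. Then, for every jacket $J$ of $\mathcal G$, $$\gamma_{\mathcal G}\le 3-2g_J ,$$ and consequently $\gamma_{\mathcal G}\le 3-\frac16\,\omega(\mathcal G)$. -/

import Mathlib

open MeasureTheory Filter Topology

/-! ## Coloured graphs, faces and jackets -/

/-- A closed (vacuum) bipartite `n`-coloured graph with white nodes `W` and black nodes `B`.
The lines of color `ℓ` pair every white node with a black node, so that exactly one line of each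
color meets every node: the line of color `ℓ` at the white node `w` joins `w` to `line ℓ w`.
Several lines (of distinct colors) may join the same two nodes. -/
structure ColoredGraph (n : ℕ) (W B : Type*) where
  line : Fin n → W ≃ B

namespace ColoredGraph

variable {n : ℕ} {W B : Type*}

/-- The graph on all nodes that keeps only the lines with a color in `S`. -/
def colorSubgraph (Γ : ColoredGraph n W B) (S : Finset (Fin n)) : SimpleGraph (W ⊕ B) :=
  SimpleGraph.fromRel fun x y => ∃ w : W, ∃ ℓ ∈ S, x = Sum.inl w ∧ y = Sum.inr (Γ.line ℓ w)

def IsConnected (Γ : ColoredGraph n W B) : Prop :=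
  (Γ.colorSubgraph Finset.univ).Connected

/-- For a pair of colors `p = {i, j}`, a face of color `(i j)` is a connected component of the
subgraph made of the lines of colors `i` and `j`. -/
abbrev Face (Γ : ColoredGraph n W B) (p : Finset (Fin n)) : Type _ :=
  (Γ.colorSubgraph p).ConnectedComponent

end ColoredGraph

/-- The jackets of 5-coloured graphs. The jacket of a cycle `(σ 0, σ 1, σ 2, σ 3, σ 4)` of the
colors is recorded as the set of the five pairs `{σ ℓ, σ (ℓ + 1)}` of cyclically consecutive
colors (addition modulo 5). A cycle and its inverse give the same set, and this is the only
coincidence. -/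
def jackets : Finset (Finset (Finset (Fin 5))) :=
  Finset.univ.image fun σ : Equiv.Perm (Fin 5) =>
    Finset.univ.image fun ℓ : Fin 5 => {σ ℓ, σ (ℓ + 1)}

namespace ColoredGraph

variable {W B : Type*} [Fintype W] [Fintype B]

/-- The order of the graph: its number of nodes. -/
def order {n : ℕ} (_Γ : ColoredGraph n W B) : ℕ := Fintype.card (W ⊕ B)

/-- The number of lines; a line is determined by its color and its white end. -/
def numLines {n : ℕ} (_Γ : ColoredGraph n W B) : ℕ := Fintype.card (Fin n × W)

/-- Euler characteristic of the jacket `J`, the closed surface whose vertices and edges are the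
nodes and lines of the graph, and whose 2-cells are the faces with colors in `J`. -/
noncomputable def jacketEulerChar (Γ : ColoredGraph 5 W B) (J : Finset (Finset (Fin 5))) : ℤ :=
  (Γ.order : ℤ) - (Γ.numLines : ℤ) + ∑ p ∈ J, (Nat.card (Γ.Face p) : ℤ)

/-- The genus `g` of a jacket (a closed orientable surface, connected when the graph is), given
by `χ = 2 - 2 g`. -/
noncomputable def jacketGenus (Γ : ColoredGraph 5 W B) (J : Finset (Finset (Fin 5))) : ℝ :=
  1 - (Γ.jacketEulerChar J : ℝ) / 2

/-- The degree of the graph: the sum of the genera of its jackets. -/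
noncomputable def degree (Γ : ColoredGraph 5 W B) : ℝ := ∑ J ∈ jackets, Γ.jacketGenus J

end ColoredGraph

/-! ## The group `SU(2) × SU(2)` and its regularized delta functions -/

abbrev SU2 : Type := ↥(Matrix.specialUnitaryGroup (Fin 2) ℂ)

instance : IsTopologicalGroup SU2 where
  continuous_inv := by
    refine continuous_induced_rng.mpr ?_
    exact continuous_subtype_val.star

instance : CompactSpace SU2 := by
  refine isCompact_iff_compactSpace.mp ?_
  have hK : IsCompact
      (Set.pi Set.univ fun _ : Fin 2 => Set.pi Set.univ fun _ : Fin 2 =>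
        Metric.closedBall (0 : ℂ) 1) :=
    isCompact_univ_pi fun _ => isCompact_univ_pi fun _ => isCompact_closedBall _ _
  refine hK.of_isClosed_subset ?_ ?_
  · have h1 : IsClosed {A : Matrix (Fin 2) (Fin 2) ℂ | A * star A = 1} :=
      isClosed_eq (by fun_prop) continuous_const
    have h2 : IsClosed {A : Matrix (Fin 2) (Fin 2) ℂ | A.det = 1} :=
      isClosed_eq (by fun_prop) continuous_const
    have h3 : (Matrix.specialUnitaryGroup (Fin 2) ℂ : Set (Matrix (Fin 2) (Fin 2) ℂ)) =
        {A | A * star A = 1} ∩ {A | A.det = 1} := by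
      ext A
      simp [Matrix.mem_specialUnitaryGroup_iff, Matrix.mem_unitaryGroup_iff]
    rw [h3]
    exact h1.inter h2
  · intro A hA i _ j _
    rw [mem_closedBall_zero_iff]
    exact entry_norm_bound_of_unitary (Matrix.mem_specialUnitaryGroup_iff.mp hA).1 i j

noncomputable instance : MeasurableSpace SU2 := borel SU2

instance : BorelSpace SU2 := ⟨rfl⟩

/-- The normalized Haar measure of `SU(2)`. -/
noncomputable def su2Haar : Measure SU2 := Measure.haarMeasure ⊤

/-- The cover `SU(2) × SU(2)` of the gauge group; `g = (g⁺, g⁻)`. -/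
abbrev GaugeGroup : Type := SU2 × SU2

/-- The normalized Haar measure of `SU(2) × SU(2)`. -/
noncomputable def gaugeHaar : Measure GaugeGroup := su2Haar.prod su2Haar

/-- The character `χ_j` of the irreducible representation of `SU(2)` of spin `j = m / 2` and
dimension `m + 1`: the Chebyshev polynomial `U_m` of half the trace, that is
`sin ((m + 1) ψ) / sin ψ` where `ψ` is the class angle. -/
noncomputable def su2Character (m : ℕ) (A : Matrix (Fin 2) (Fin 2) ℂ) : ℝ :=
  (Polynomial.Chebyshev.U ℝ m).eval (A.trace.re / 2)

/-- The heat kernel `K_α = ∑_j (2j + 1) exp (-α j (j + 1)) χ_j` of `SU(2)`, with `j = m / 2`. -/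
noncomputable def heatKernel (α : ℝ) (A : Matrix (Fin 2) (Fin 2) ℂ) : ℝ :=
  ∑' m : ℕ, ((m : ℝ) + 1) * Real.exp (-α * ((m : ℝ) / 2 * ((m : ℝ) / 2 + 1))) * su2Character m A

/-- `δ_α (z g) = K_α (z⁺ g⁺) K_α (z⁻ g⁻)`, for `z` in the centre `{±1} × {±1}` of
`SU(2) × SU(2)`. -/
noncomputable def deltaReg (α : ℝ) (z : ℤˣ × ℤˣ) (g : GaugeGroup) : ℝ :=
  heatKernel α (z.1 • (g.1 : Matrix (Fin 2) (Fin 2) ℂ)) *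
    heatKernel α (z.2 • (g.2 : Matrix (Fin 2) (Fin 2) ℂ))

/-- The value `δ_α(1)` of the regularized delta function at the identity. -/
noncomputable def deltaRegOne (α : ℝ) : ℝ := deltaReg α 1 1

open Classical in
/-- The average of `δ_α` over a subgroup `Z` of the centre: the function that `δ_α` induces on
`(SU(2) × SU(2)) / Z`. -/
noncomputable def deltaRegMod (Z : Subgroup (ℤˣ × ℤˣ)) (α : ℝ) (g : GaugeGroup) : ℝ :=
  (∑ z ∈ Finset.univ.filter (· ∈ Z), deltaReg α z g) / (Nat.card Z : ℝ)

/-! ## Feynman amplitudes of the coloured Ooguri model in edge variables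

The propagator of a line of color `ℓ` identifies the six edge variables `G_{ij}` (`i, j ≠ ℓ`) of
its two ends, and carries the (unregularized) closure constraint
`δ(G₁₂ G₂₄ G₄₁) δ(G₂₃ G₃₄ G₄₂) δ(G₃₁ G₁₄ G₄₃)` (written for `ℓ = 5`). Its solutions
are exactly `G_{ij} = g_i⁻¹ g_j`, and integrating a function of the `G_{ij}` against the constraint
is integrating it over the `g_i` with the normalized Haar measure. When the fields live on
`(SU(2) × SU(2)) / Z`, the delta functions of the propagator hold modulo `Z`; every end variable
enters exactly one of the ten holonomies of its node, so this replaces `δ_α` by its average over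
`Z` in the interaction kernel. -/

/-- The edge variable `G_{ij} = g_i⁻¹ g_j`. -/
def edgeVar (g : Fin 5 → GaugeGroup) (i j : Fin 5) : GaugeGroup := (g i)⁻¹ * g j

/-- The holonomy `H_{ijk} = G^i_{jk} G^k_{ij} G^j_{ki}`; here `u ℓ` are the variables of the line of
color `ℓ` at the node. -/
def holonomy (u : Fin 5 → Fin 5 → GaugeGroup) (i j k : Fin 5) : GaugeGroup :=
  edgeVar (u i) j k * edgeVar (u k) i j * edgeVar (u j) k i

/-- The regularized interaction kernel
`𝒱_α = δ_α(1)⁻⁴ ∏_{i < j < k} δ_α(H_{ijk})`, the product running over the ten triples of colors.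
It is real, and is used at white and at black nodes. -/
noncomputable def interactionKernel (Z : Subgroup (ℤˣ × ℤˣ)) (α : ℝ)
    (u : Fin 5 → Fin 5 → GaugeGroup) : ℝ :=
  (deltaRegOne α ^ 4)⁻¹ *
    ∏ t ∈ (Finset.univ : Finset (Fin 5 × Fin 5 × Fin 5)).filter
        (fun t => t.1 < t.2.1 ∧ t.2.1 < t.2.2),
      deltaRegMod Z α (holonomy u t.1 t.2.1 t.2.2)

namespace ColoredGraph

variable {W B : Type*} [Fintype W] [Fintype B]

/-- The integrand of the amplitude. `g (ℓ, w, i)`, for `i ≠ ℓ`, are the variables `g_i` of the line of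
color `ℓ` at the white node `w`; the variables with `i = ℓ` do not occur, so they integrate
to `1`. -/
noncomputable def amplitudeIntegrand (Γ : ColoredGraph 5 W B) (Z : Subgroup (ℤˣ × ℤˣ)) (α : ℝ)
    (g : Fin 5 × W × Fin 5 → GaugeGroup) : ℝ :=
  (∏ w : W, interactionKernel Z α fun ℓ i => g (ℓ, w, i)) *
    ∏ b : B, interactionKernel Z α fun ℓ i => g (ℓ, (Γ.line ℓ).symm b, i)

/-- The regularized amplitude `𝒜^α` of the graph, without coupling constants. -/
noncomputable def amplitude (Γ : ColoredGraph 5 W B) (Z : Subgroup (ℤˣ × ℤˣ)) (α : ℝ) : ℝ :=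
  ∫ g, Γ.amplitudeIntegrand Z α g ∂(Measure.pi fun _ : Fin 5 × W × Fin 5 => gaugeHaar)

/-- The amplitude after the rescaling `λ → λ / δ_α(1)^{3/2}`: one factor per node. -/
noncomputable def rescaledAmplitude (Γ : ColoredGraph 5 W B) (Z : Subgroup (ℤˣ × ℤˣ))
    (α : ℝ) : ℝ :=
  deltaRegOne α ^ (-(3 / 2 : ℝ) * (Γ.order : ℝ)) * Γ.amplitude Z α

/-- The divergence degree, an extended real: the infimum of the real `γ` for which
`δ_α(1)^{-γ} 𝒜^α` has a finite limit as `α → 0⁺`, for the rescaled amplitude. -/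
noncomputable def divergenceDegree (Γ : ColoredGraph 5 W B) (Z : Subgroup (ℤˣ × ℤˣ)) : EReal :=
  sInf {x : EReal | ∃ γ : ℝ, x = (γ : EReal) ∧ ∃ L : ℝ,
    Tendsto (fun α : ℝ => deltaRegOne α ^ (-γ) * Γ.rescaledAmplitude Z α) (𝓝[>] 0) (𝓝 L)}

end ColoredGraph

/-! ## Invariance of the Haar measure -/

/-! Write `D` for `deltaRegOne α`, `N` for the number of nodes and `F` for the number of faces of
the jacket of `σ`. The heart of the proof is the bound |amplitude| ≤ D ^ (1 + F) of
`abs_amplitude_le`. A jacket has Euler characteristic N - 5N/2 + F, so after the rescaling the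
exponent 1 + F - 3N/2 equals 3 - 2g. The bound by the degree follows because the largest of the
twelve genera is at least their mean.

The averaged delta function is a class function, invariant under inversion, with values in [0, D]
and integral 1. Nonnegativity is the nontrivial point: the heat kernel is a limit of derivatives of
finite Jacobi triple products. Hence each holonomy weight can be either bounded by D or, if a Haar
variable can be isolated in it, integrated to 1.

After conjugation, a holonomy is a product of three transports between pairs of lines at a node. If
the face of colors a, b through u reaches a node of S, multiplying variables along a path of that
face by a group element h changes the (a, b) transport at u and no other transport outside S
(`exists_separating`). One weight at u that contains this transport then integrates to 1, provided
that the other factors do not contain it (`lintegral_mul_tripleWeight`).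

The nodes are eliminated one at a time, the eliminated set S growing along lines of the connected
graph. Each node has five inner triples, consecutive along the cycle `σ`, and five outer ones, each
with a single jacket pair. At a new node u, four inner weights are bounded by D, which uses up the
normalization D ^ (-4). The remaining inner weight and every outer weight whose jacket face meets S
are integrated to 1; an outer weight costs D only when its face is new. So each face away from the
root is paid for once, and the ten weights at the root cost D ^ 10. In total 10 + 4(N - 1) + (F - 5)
= 4N + 1 + F. -/

instance : SecondCountableTopology SU2 := by
  have : SecondCountableTopology (Matrix (Fin 2) (Fin 2) ℂ) :=
    inferInstanceAs (SecondCountableTopology (Fin 2 → Fin 2 → ℂ))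
  exact TopologicalSpace.Subtype.secondCountableTopology _

instance : su2Haar.IsHaarMeasure := by unfold su2Haar; infer_instance

instance : IsProbabilityMeasure su2Haar :=
  ⟨by simpa [su2Haar] using Measure.haarMeasure_self (K₀ := (⊤ : TopologicalSpace.PositiveCompacts SU2))⟩

instance : su2Haar.IsMulRightInvariant where
  map_mul_right_eq_self g := by
    have : IsProbabilityMeasure (su2Haar.map (· * g)) :=
      Measure.isProbabilityMeasure_map (by fun_prop)
    exact Measure.isHaarMeasure_eq_of_isProbabilityMeasure _ _

instance : su2Haar.IsInvInvariant where
  inv_eq_self := by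
    have : IsProbabilityMeasure su2Haar.inv :=
      Measure.isProbabilityMeasure_map (by fun_prop)
    have : su2Haar.inv.IsHaarMeasure :=
      Measure.isHaarMeasure_of_isCompact_nonempty_interior _ Set.univ isCompact_univ
        (by simp) (by simp) (by simp)
    exact Measure.isHaarMeasure_eq_of_isProbabilityMeasure _ _

instance : gaugeHaar.IsHaarMeasure := by unfold gaugeHaar; infer_instance
instance : IsProbabilityMeasure gaugeHaar := by unfold gaugeHaar; infer_instance
instance : gaugeHaar.IsMulRightInvariant := by unfold gaugeHaar; infer_instance
instance : gaugeHaar.IsInvInvariant := by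
  unfold gaugeHaar
  refine ⟨?_⟩
  have h := Measure.map_prod_map su2Haar su2Haar (f := Inv.inv) (g := Inv.inv)
    measurable_inv measurable_inv
  have h1 : su2Haar.map Inv.inv = su2Haar := Measure.map_inv_eq_self _
  rw [h1] at h
  exact h.symm

theorem lintegral_gaugeHaar_mul_mul {f : GaugeGroup → ENNReal} (A B : GaugeGroup) :
    ∫⁻ h, f (A * h * B) ∂gaugeHaar = ∫⁻ h, f h ∂gaugeHaar := by
  have h1 := lintegral_mul_left_eq_self (μ := gaugeHaar) (fun h => f (h * B)) A
  have h2 := lintegral_mul_right_eq_self (μ := gaugeHaar) f B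
  rw [← h2, ← h1]

theorem lintegral_gaugeHaar_mul_inv_mul {f : GaugeGroup → ENNReal} (A B : GaugeGroup) :
    ∫⁻ h, f (A * h⁻¹ * B) ∂gaugeHaar = ∫⁻ h, f h ∂gaugeHaar := by
  rw [← lintegral_gaugeHaar_mul_mul (f := f) A B]
  exact lintegral_inv_eq_self (μ := gaugeHaar) (fun h => f (A * h * B))

/-! ## Chebyshev polynomials on `[-1, 1]` -/

-- Induction through U_{m+1} = x U_m + T_{m+1}, where |T_{m+1}| ≤ 1 on [-1, 1].
open Polynomial Polynomial.Chebyshev in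
theorem abs_eval_U_le {x : ℝ} (hx : |x| ≤ 1) (m : ℕ) : |(U ℝ m).eval x| ≤ m + 1 := by
  induction m with
  | zero => simp
  | succ m ih =>
    have h := congrArg (Polynomial.eval x) (U_eq_X_mul_U_add_T ℝ m)
    simp only [eval_add, eval_mul, eval_X] at h
    push_cast
    rw [h]
    have hT := abs_eval_T_real_le_one ((m : ℤ) + 1) hx
    calc _ ≤ |x * (U ℝ m).eval x| + |(T ℝ (m + 1)).eval x| := abs_add_le _ _
      _ ≤ (m + 1) + 1 := by
        gcongr
        rw [abs_mul]
        calc |x| * |(U ℝ m).eval x| ≤ 1 * (m + 1) := by gcongr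
          _ = _ := one_mul _

/-! ## The characters and the heat kernel -/

theorem SU2.abs_trace_re_div_two_le (g : SU2) :
    |(g : Matrix (Fin 2) (Fin 2) ℂ).trace.re / 2| ≤ 1 := by
  have h0 := entry_norm_bound_of_unitary (Matrix.mem_specialUnitaryGroup_iff.mp g.2).1
  have h1 := (Complex.abs_re_le_norm _).trans (h0 0 0)
  have h2 := (Complex.abs_re_le_norm _).trans (h0 1 1)
  rw [Matrix.trace_fin_two, Complex.add_re]
  rw [abs_le] at *
  constructor <;> linarith [h1.1, h1.2, h2.1, h2.2]

/-- The Boltzmann weights of the heat kernel, including the dimension. -/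
noncomputable def heatWeight (α : ℝ) (m : ℕ) : ℝ :=
  ((m : ℝ) + 1) * Real.exp (-α * ((m : ℝ) / 2 * ((m : ℝ) / 2 + 1)))

theorem heatWeight_nonneg (α : ℝ) (m : ℕ) : 0 ≤ heatWeight α m := by
  unfold heatWeight; positivity

theorem summable_heatWeight_mul {α : ℝ} (hα : 0 < α) :
    Summable fun m : ℕ => heatWeight α m * ((m : ℝ) + 1) := by
  have h : Summable fun m : ℕ => ((m : ℝ) + 1) ^ 2 * Real.exp (-(α / 2)) ^ m := by
    have hr : ‖Real.exp (-(α / 2))‖ < 1 := by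
      rw [Real.norm_of_nonneg (Real.exp_pos _).le, Real.exp_lt_one_iff]; linarith
    have a2 := summable_pow_mul_geometric_of_norm_lt_one 2 hr
    have a1 := summable_pow_mul_geometric_of_norm_lt_one 1 hr
    have a0 := summable_pow_mul_geometric_of_norm_lt_one 0 hr
    refine ((a2.add (a1.mul_left 2)).add a0).congr fun m => ?_
    ring
  refine Summable.of_nonneg_of_le (fun m => ?_) (fun m => ?_) h
  · have := heatWeight_nonneg α m; positivity
  · unfold heatWeight
    rw [← Real.exp_nat_mul]
    have : Real.exp (-α * ((m : ℝ) / 2 * ((m : ℝ) / 2 + 1))) ≤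
        Real.exp (m * -(α / 2)) := by
      apply Real.exp_le_exp.mpr
      have : 0 ≤ α * (m : ℝ) ^ 2 := by positivity
      nlinarith
    nlinarith [sq_nonneg ((m : ℝ) + 1)]

theorem heatKernel_eq_tsum (α : ℝ) (A : Matrix (Fin 2) (Fin 2) ℂ) :
    heatKernel α A = ∑' m : ℕ, heatWeight α m * su2Character m A := rfl

theorem abs_su2Character_le {A : Matrix (Fin 2) (Fin 2) ℂ} (hA : |A.trace.re / 2| ≤ 1) (m : ℕ) :
    |su2Character m A| ≤ m + 1 := abs_eval_U_le hA m

theorem norm_heatTerm_le {A : Matrix (Fin 2) (Fin 2) ℂ} (hA : |A.trace.re / 2| ≤ 1)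
    (α : ℝ) (m : ℕ) :
    ‖heatWeight α m * su2Character m A‖ ≤ heatWeight α m * ((m : ℝ) + 1) := by
  rw [norm_mul, Real.norm_of_nonneg (heatWeight_nonneg α m)]
  exact mul_le_mul_of_nonneg_left (abs_su2Character_le hA m) (heatWeight_nonneg α m)

theorem su2Character_one (m : ℕ) : su2Character m 1 = m + 1 := by
  have : ((1 : Matrix (Fin 2) (Fin 2) ℂ).trace.re / 2) = 1 := by simp
  rw [su2Character, this, Polynomial.Chebyshev.U_eval_one]
  push_cast; rfl

theorem heatKernel_one (α : ℝ) :
    heatKernel α 1 = ∑' m : ℕ, heatWeight α m * ((m : ℝ) + 1) := by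
  simp only [heatKernel_eq_tsum, su2Character_one]

theorem abs_heatKernel_le {α : ℝ} (hα : 0 < α) {A : Matrix (Fin 2) (Fin 2) ℂ}
    (hA : |A.trace.re / 2| ≤ 1) : |heatKernel α A| ≤ heatKernel α 1 := by
  rw [heatKernel_one, heatKernel_eq_tsum]
  exact tsum_of_norm_bounded (summable_heatWeight_mul hα).hasSum fun m => norm_heatTerm_le hA α m

/-- The terms are nonnegative, so a partial sum is a lower bound, and its limit at α = 0 is a sum of
squares (m + 1)², which exceeds any constant. -/
theorem tendsto_heatKernel_one : Tendsto (fun α : ℝ => heatKernel α 1) (𝓝[>] 0) atTop := by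
  refine tendsto_atTop.mpr fun C => ?_
  obtain ⟨M, hM⟩ := exists_nat_gt C
  have hlim : Tendsto (fun α : ℝ => ∑ m ∈ Finset.range M, heatWeight α m * ((m : ℝ) + 1))
      (𝓝[>] 0) (𝓝 (∑ m ∈ Finset.range M, ((m : ℝ) + 1) * ((m : ℝ) + 1))) := by
    refine (Continuous.tendsto' ?_ _ _ ?_).mono_left nhdsWithin_le_nhds
    · unfold heatWeight; fun_prop
    · simp [heatWeight]
  have hlt : C < ∑ m ∈ Finset.range M, ((m : ℝ) + 1) * ((m : ℝ) + 1) := by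
    refine hM.trans_le ?_
    calc (M : ℝ) = ∑ m ∈ Finset.range M, (1 : ℝ) := by simp
      _ ≤ _ := Finset.sum_le_sum fun m _ => by nlinarith [(Nat.cast_nonneg m : (0 : ℝ) ≤ m)]
  filter_upwards [hlim.eventually (lt_mem_nhds hlt), self_mem_nhdsWithin] with α h hα
  rw [heatKernel_one]
  exact h.le.trans ((summable_heatWeight_mul hα).sum_le_tsum _
    fun m _ => mul_nonneg (heatWeight_nonneg α m) (by positivity))

theorem heatKernel_one_pos {α : ℝ} (hα : 0 < α) : 0 < heatKernel α 1 := by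
  rw [heatKernel_one]
  refine (summable_heatWeight_mul hα).tsum_pos
    (fun m => mul_nonneg (heatWeight_nonneg α m) (by positivity)) 0 ?_
  simp [heatWeight]

/-! ## Vanishing of the averages of the nontrivial characters -/

theorem mem_specialUnitaryGroup_of_normSq {p q : ℂ}
    (h : Complex.normSq p + Complex.normSq q = 1) :
    !![p, q; -(starRingEnd ℂ q), starRingEnd ℂ p] ∈ Matrix.specialUnitaryGroup (Fin 2) ℂ := by
  have h' : p * starRingEnd ℂ p + q * starRingEnd ℂ q = 1 := by
    rw [Complex.mul_conj, Complex.mul_conj]; exact_mod_cast h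
  rw [Matrix.mem_specialUnitaryGroup_iff, Matrix.mem_unitaryGroup_iff]
  refine ⟨?_, ?_⟩
  · ext i j
    fin_cases i <;> fin_cases j <;> simp [Matrix.mul_apply, Fin.sum_univ_two, Matrix.star_apply]
    · linear_combination h'
    · ring
    · ring
    · linear_combination h'
  · rw [Matrix.det_fin_two_of]
    linear_combination h'

/-- The one-parameter subgroup of `SU(2)` generated by the vector `(x, y, t)`. -/
noncomputable def su2Rotation (x y t θ : ℝ) (h : x ^ 2 + y ^ 2 + t ^ 2 = 1) : SU2 :=
  ⟨_, mem_specialUnitaryGroup_of_normSq (p := ⟨Real.cos θ, x * Real.sin θ⟩)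
    (q := ⟨y * Real.sin θ, t * Real.sin θ⟩) (by
      simp only [Complex.normSq_mk]
      linear_combination Real.sin θ ^ 2 * h + Real.sin_sq_add_cos_sq θ)⟩

/-- The half-trace of an element of `SU(2)`. -/
noncomputable def SU2.scalarPart (g : SU2) : ℝ := (g.1 0 0).re

/-- The component of a unit quaternion along `(x, y, t)`. -/
noncomputable def SU2.vectorPart (x y t : ℝ) (g : SU2) : ℝ :=
  -x * (g.1 0 0).im + y * (g.1 1 0).re - t * (g.1 1 0).im

theorem SU2.scalarPart_rotation_mul {x y t : ℝ} (θ : ℝ) (h : x ^ 2 + y ^ 2 + t ^ 2 = 1) (g : SU2) :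
    (su2Rotation x y t θ h * g).scalarPart =
      Real.cos θ * g.scalarPart + Real.sin θ * g.vectorPart x y t := by
  simp [SU2.scalarPart, SU2.vectorPart, su2Rotation, Matrix.mul_apply, Fin.sum_univ_two]
  ring

theorem SU2.vectorPart_rotation_mul {x y t : ℝ} (θ : ℝ) (h : x ^ 2 + y ^ 2 + t ^ 2 = 1) (g : SU2) :
    (su2Rotation x y t θ h * g).vectorPart x y t =
      Real.cos θ * g.vectorPart x y t - Real.sin θ * g.scalarPart := by
  simp [SU2.scalarPart, SU2.vectorPart, su2Rotation, Matrix.mul_apply, Fin.sum_univ_two]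
  linear_combination (-Real.sin θ * (g.1 0 0).re) * h

theorem SU2.continuous_entry (i j : Fin 2) : Continuous fun g : SU2 => g.1 i j :=
  (continuous_apply_apply i j).comp continuous_subtype_val

theorem SU2.continuous_scalarPart : Continuous SU2.scalarPart :=
  Complex.continuous_re.comp (SU2.continuous_entry 0 0)

theorem SU2.continuous_vectorPart (x y t : ℝ) : Continuous (SU2.vectorPart x y t) := by
  have h0 := SU2.continuous_entry 0 0
  have h1 := SU2.continuous_entry 1 0
  have h2 := Complex.continuous_re.comp h1
  have h3 := Complex.continuous_im.comp h1
  exact ((continuous_const.mul (Complex.continuous_im.comp h0)).add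
    (continuous_const.mul h2)).sub (continuous_const.mul h3)

theorem SU2.entry_eq (g : SU2) : g.1 1 1 = starRingEnd ℂ (g.1 0 0) := by
  obtain ⟨hU, hdet⟩ := Matrix.mem_specialUnitaryGroup_iff.mp g.2
  have hinv : star g.1 = g.1.adjugate := by
    have h1 : g.1 * star g.1 = 1 := Matrix.mem_unitaryGroup_iff.mp hU
    have h2 : g.1.adjugate * g.1 = 1 := by rw [Matrix.adjugate_mul, hdet, one_smul]
    calc star g.1 = (g.1.adjugate * g.1) * star g.1 := by rw [h2, one_mul]
      _ = g.1.adjugate := by rw [mul_assoc, h1, mul_one]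
  have := congrFun (congrFun hinv 0) 0
  simpa [Matrix.adjugate_fin_two] using this.symm

theorem SU2.trace_re_div_two (g : SU2) : g.1.trace.re / 2 = g.scalarPart := by
  rw [Matrix.trace_fin_two, g.entry_eq]
  simp [SU2.scalarPart]

theorem SU2.sq_sum (g : SU2) :
    g.scalarPart ^ 2 + (g.vectorPart 1 0 0 ^ 2 + g.vectorPart 0 1 0 ^ 2 +
      g.vectorPart 0 0 1 ^ 2) = 1 := by
  have h1 : star g.1 * g.1 = 1 :=
    Matrix.mem_unitaryGroup_iff'.mp (Matrix.mem_specialUnitaryGroup_iff.mp g.2).1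
  have := congrArg Complex.re (congrFun (congrFun h1 0) 0)
  simp [Matrix.mul_apply, Fin.sum_univ_two, Matrix.star_apply] at this
  simp only [SU2.scalarPart, SU2.vectorPart]
  linear_combination this

theorem SU2.integrable_of_continuous {f : SU2 → ℝ} (hf : Continuous f) :
    Integrable f su2Haar :=
  hf.integrable_of_hasCompactSupport (HasCompactSupport.of_compactSpace f)

-- The Haar integral of u · P(a), with a the scalar part and u the vector part, does not change
-- under left translation by a one-parameter subgroup. The identity is its derivative at θ = 0,
-- where a' = u and u' = -a.
open Polynomial in
theorem SU2.integral_infinitesimal_rotation {x y t : ℝ} (h : x ^ 2 + y ^ 2 + t ^ 2 = 1)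
    (P : ℝ[X]) :
    ∫ g : SU2, (g.vectorPart x y t ^ 2 * (derivative P).eval g.scalarPart -
      g.scalarPart * P.eval g.scalarPart) ∂su2Haar = 0 := by
  set a := SU2.scalarPart
  set u := SU2.vectorPart x y t
  have ha : Continuous a := SU2.continuous_scalarPart
  have hu : Continuous u := SU2.continuous_vectorPart x y t
  let a' : ℝ → SU2 → ℝ := fun θ g => Real.cos θ * a g + Real.sin θ * u g
  let u' : ℝ → SU2 → ℝ := fun θ g => Real.cos θ * u g - Real.sin θ * a g
  let F : ℝ → SU2 → ℝ := fun θ g => u' θ g * P.eval (a' θ g)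
  let F' : ℝ → SU2 → ℝ := fun θ g =>
    u' θ g ^ 2 * (derivative P).eval (a' θ g) - a' θ g * P.eval (a' θ g)
  have hF'c : Continuous (Function.uncurry F') := by
    simp only [F', a', u', Function.uncurry_def]
    fun_prop
  have hFc : ∀ θ, Continuous (F θ) := fun θ => by
    simp only [F, a', u']
    fun_prop
  obtain ⟨C, hC⟩ := ((isCompact_Icc (a := (-1 : ℝ)) (b := 1)).prod
    (isCompact_univ (X := SU2))).exists_bound_of_continuousOn hF'c.continuousOn
  have hderiv : ∀ (g : SU2) (θ : ℝ), HasDerivAt (fun θ => F θ g) (F' θ g) θ := by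
    intro g θ
    have h1 : HasDerivAt (fun θ => a' θ g) (u' θ g) θ := by
      have := ((Real.hasDerivAt_cos θ).mul_const (a g)).add
        ((Real.hasDerivAt_sin θ).mul_const (u g))
      refine this.congr_deriv ?_
      simp only [u']; ring
    have h2 : HasDerivAt (fun θ => u' θ g) (-a' θ g) θ := by
      have := ((Real.hasDerivAt_cos θ).mul_const (u g)).sub
        ((Real.hasDerivAt_sin θ).mul_const (a g))
      refine this.congr_deriv ?_
      simp only [a']; ring
    have h3 := h2.mul ((P.hasDerivAt (a' θ g)).comp θ h1)
    refine h3.congr_deriv ?_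
    simp only [F', Function.comp]; ring
  have hmain := (hasDerivAt_integral_of_dominated_loc_of_deriv_le (μ := su2Haar) (F := F)
    (F' := F') (x₀ := (0 : ℝ)) (s := Set.Icc (-1) 1) (bound := fun _ => C)
    (Icc_mem_nhds (by norm_num) (by norm_num))
    (Eventually.of_forall fun θ => (hFc θ).aestronglyMeasurable)
    (SU2.integrable_of_continuous (hFc 0))
    (hF'c.comp (Continuous.prodMk_right (0 : ℝ))).aestronglyMeasurable
    (Eventually.of_forall fun g θ hθ => hC (θ, g) ⟨hθ, Set.mem_univ _⟩)
    (integrable_const C)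
    (Eventually.of_forall fun g θ _ => hderiv g θ)).2
  -- Left invariance makes the integral constant in θ, so the derivative under the integral sign
  -- vanishes.
  have hconst : (fun θ => ∫ g, F θ g ∂su2Haar) = fun _ => ∫ g, u g * P.eval (a g) ∂su2Haar := by
    funext θ
    rw [← integral_mul_left_eq_self (μ := su2Haar) (fun g => u g * P.eval (a g))
      (su2Rotation x y t θ h)]
    simp only [F, a', u', a, u, SU2.scalarPart_rotation_mul, SU2.vectorPart_rotation_mul]
  rw [hconst] at hmain
  have := hmain.unique (hasDerivAt_const (0 : ℝ) _)
  simpa [F', a', u'] using this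

-- The operator is the Laplacian of the 3-sphere on functions of the scalar part. It arises by
-- adding the previous identity, applied to P', over three orthogonal directions: the squares of the
-- vector parts add up to 1 - a².
open Polynomial in
theorem SU2.integral_laplacian (P : ℝ[X]) :
    ∫ g : SU2, ((1 - X ^ 2) * derivative^[2] P - 3 * X * derivative P).eval g.scalarPart ∂su2Haar
      = 0 := by
  have ha := SU2.continuous_scalarPart
  have key : ∀ x y t : ℝ, Integrable (fun g : SU2 => g.vectorPart x y t ^ 2 *
      (derivative (derivative P)).eval g.scalarPart -
        g.scalarPart * (derivative P).eval g.scalarPart) su2Haar := fun x y t => by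
    have := SU2.continuous_vectorPart x y t
    exact SU2.integrable_of_continuous (by fun_prop)
  have h1 := SU2.integral_infinitesimal_rotation (x := 1) (y := 0) (t := 0) (by norm_num)
    (derivative P)
  have h2 := SU2.integral_infinitesimal_rotation (x := 0) (y := 1) (t := 0) (by norm_num)
    (derivative P)
  have h3 := SU2.integral_infinitesimal_rotation (x := 0) (y := 0) (t := 1) (by norm_num)
    (derivative P)
  have hsum := integral_add ((key 1 0 0).add (key 0 1 0)) (key 0 0 1)
  have hsum' := integral_add (key 1 0 0) (key 0 1 0)
  simp only [Pi.add_apply] at hsum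
  rw [hsum', h1, h2, h3] at hsum
  refine Eq.trans ?_ (hsum.trans (by simp))
  congr 1
  funext g
  simp only [eval_sub, eval_mul, eval_one, eval_pow, eval_X, Function.iterate_succ,
    Function.iterate_zero, Function.comp, id, eval_ofNat]
  linear_combination (-(derivative (derivative P)).eval g.scalarPart) * g.sq_sum

-- U_m is an eigenfunction of the Laplacian with eigenvalue -m(m + 2), nonzero for m ≠ 0, whereas
-- the integral of a Laplacian is zero.
open Polynomial in
theorem integral_su2Character_eq_zero {m : ℕ} (hm : m ≠ 0) :
    ∫ g : SU2, su2Character m g ∂su2Haar = 0 := by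
  have h := SU2.integral_laplacian (Chebyshev.U ℝ m)
  rw [Chebyshev.one_sub_X_sq_mul_derivative_derivative_U_eq_poly_in_U, sub_sub_cancel_left] at h
  have h' : ∀ g : SU2, (-((((m : ℤ) : ℝ[X]) + 2) * ((m : ℤ) : ℝ[X]) * Chebyshev.U ℝ m)).eval
      g.scalarPart = -(((m : ℝ) + 2) * m) * su2Character m g := fun g => by
    simp [su2Character, SU2.trace_re_div_two]
  simp only [h', integral_const_mul] at h
  have hm' : (0 : ℝ) < m := by exact_mod_cast Nat.pos_of_ne_zero hm
  rcases mul_eq_zero.mp h with h | h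
  · nlinarith
  · exact h

theorem continuous_su2Character (m : ℕ) : Continuous (su2Character m) := by
  unfold su2Character
  have : Continuous fun A : Matrix (Fin 2) (Fin 2) ℂ => A.trace.re / 2 := by
    have : Continuous fun A : Matrix (Fin 2) (Fin 2) ℂ => A.trace := continuous_id.matrix_trace
    fun_prop
  fun_prop

theorem continuous_heatKernel {α : ℝ} (hα : 0 < α) : Continuous fun g : SU2 => heatKernel α g := by
  simp only [heatKernel_eq_tsum]
  refine continuous_tsum (fun m => ?_) (summable_heatWeight_mul hα)
    fun m g => norm_heatTerm_le g.abs_trace_re_div_two_le α m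
  exact continuous_const.mul ((continuous_su2Character m).comp continuous_subtype_val)

theorem integral_heatKernel {α : ℝ} (hα : 0 < α) : ∫ g : SU2, heatKernel α g ∂su2Haar = 1 := by
  have hc : ∀ m, Continuous fun g : SU2 => heatWeight α m * su2Character m g := fun m =>
    continuous_const.mul ((continuous_su2Character m).comp continuous_subtype_val)
  have h := hasSum_integral_of_summable_integral_norm (μ := su2Haar)
    (F := fun (m : ℕ) (g : SU2) => heatWeight α m * su2Character m g)
    (fun m => SU2.integrable_of_continuous (hc m)) (by
      refine Summable.of_nonneg_of_le (fun m => integral_nonneg fun g => norm_nonneg _)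
        (fun m => ?_) (summable_heatWeight_mul hα)
      calc _ ≤ ∫ _ : SU2, heatWeight α m * ((m : ℝ) + 1) ∂su2Haar :=
            integral_mono (SU2.integrable_of_continuous (hc m).norm) (integrable_const _)
              fun g => norm_heatTerm_le g.abs_trace_re_div_two_le α m
        _ = _ := by simp)
  have h0 := hasSum_single (f := fun m => ∫ g : SU2, heatWeight α m * su2Character m g ∂su2Haar) 0
    (fun m hm => by simp only [integral_const_mul, integral_su2Character_eq_zero hm, mul_zero])
  simp only [heatKernel_eq_tsum]
  rw [h.unique h0]
  simp [heatWeight, su2Character]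

/-! ## Positivity of the heat kernel, from the finite form of Jacobi's triple product -/

/-- The inverse `q`-factorial `1 / ((1 - Q) ⋯ (1 - Q ^ k))`, extended by `0` to negative `k`. -/
noncomputable def invQFactorial (Q : ℝ) (k : ℤ) : ℝ :=
  if k < 0 then 0 else (∏ i ∈ Finset.range k.toNat, (1 - Q ^ (i + 1)))⁻¹

theorem invQFactorial_of_neg (Q : ℝ) {k : ℤ} (hk : k < 0) : invQFactorial Q k = 0 := if_pos hk

theorem one_sub_pow_pos {Q : ℝ} (h0 : 0 < Q) (h1 : Q < 1) {i : ℕ} (hi : i ≠ 0) : 0 < 1 - Q ^ i :=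
  sub_pos.mpr (pow_lt_one₀ h0.le h1 hi)

theorem invQFactorial_pos {Q : ℝ} (h0 : 0 < Q) (h1 : Q < 1) {k : ℤ} (hk : 0 ≤ k) :
    0 < invQFactorial Q k := by
  rw [invQFactorial, if_neg hk.not_gt]
  exact inv_pos.mpr (Finset.prod_pos fun i _ => one_sub_pow_pos h0 h1 i.succ_ne_zero)

theorem invQFactorial_nonneg {Q : ℝ} (h0 : 0 < Q) (h1 : Q < 1) (k : ℤ) :
    0 ≤ invQFactorial Q k := by
  rcases lt_or_ge k 0 with hk | hk
  · exact (invQFactorial_of_neg Q hk).ge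
  · exact (invQFactorial_pos h0 h1 hk).le

/-- The extension by zero is consistent with the recursion because the factor 1 - Q ^ (k + 1)
vanishes at k = -1; no range conditions on k are then needed. -/
theorem invQFactorial_step {Q : ℝ} (h0 : 0 < Q) (h1 : Q < 1) (k : ℤ) :
    invQFactorial Q k = (1 - Q ^ (k + 1)) * invQFactorial Q (k + 1) := by
  rcases lt_trichotomy k (-1) with hk | rfl | hk
  · rw [invQFactorial_of_neg Q (by omega), invQFactorial_of_neg Q (by omega), mul_zero]
  · simp [invQFactorial]
  · obtain ⟨m, rfl⟩ := Int.eq_ofNat_of_zero_le (show 0 ≤ k by omega)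
    have hp := (one_sub_pow_pos h0 h1 m.succ_ne_zero).ne'
    rw [invQFactorial, invQFactorial, if_neg (by omega), if_neg (by omega)]
    have e1 : ((m : ℤ) + 1).toNat = m + 1 := by omega
    rw [e1, Int.toNat_natCast, Finset.prod_range_succ, mul_inv]
    have e2 : Q ^ ((m : ℤ) + 1) = Q ^ (m + 1) := by exact_mod_cast zpow_natCast Q (m + 1)
    rw [e2]
    field_simp

/-- The coefficients of the finite triple product, up to normalization. -/
noncomputable def thetaCoeff (q : ℝ) (M : ℕ) (n : ℤ) : ℝ :=
  q ^ (n ^ 2) * (invQFactorial (q ^ 2) (M + n) * invQFactorial (q ^ 2) (M - n))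

theorem thetaCoeff_eq_zero (q : ℝ) {M : ℕ} {n : ℤ} (hn : n ∉ Finset.Icc (-(M : ℤ)) M) :
    thetaCoeff q M n = 0 := by
  rw [Finset.mem_Icc, not_and_or, not_le, not_le] at hn
  rcases hn with hn | hn
  · rw [thetaCoeff, invQFactorial_of_neg _ (by omega)]; simp
  · rw [thetaCoeff, invQFactorial_of_neg _ (k := M - n) (by omega)]; simp

theorem thetaCoeff_neg (q : ℝ) (M : ℕ) (n : ℤ) : thetaCoeff q M (-n) = thetaCoeff q M n := by
  rw [thetaCoeff, thetaCoeff, neg_sq, sub_neg_eq_add, ← sub_eq_add_neg, mul_comm (invQFactorial _ _)]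

theorem summable_thetaCoeff_mul (q : ℝ) (M : ℕ) (c : ℤ → ℝ) :
    Summable fun n => thetaCoeff q M n * c n :=
  summable_of_ne_finset_zero (s := Finset.Icc (-(M : ℤ)) M) fun n hn => by
    rw [thetaCoeff_eq_zero q hn, zero_mul]

/-- Coefficient form of multiplying the finite product ∏ (1 + q^{2i+1} z)(1 + q^{2i+1} z⁻¹) by its
next factor 1 + q^{4M+2} + q^{2M+1}(z + z⁻¹). The prefactor on the left is the change of
normalization: `thetaCoeff` lacks the numerator (q²; q²)_{2M} of the Gaussian binomial. -/
theorem thetaCoeff_succ {q : ℝ} (h0 : 0 < q) (h1 : q < 1) (M : ℕ) (n : ℤ) :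
    (1 - q ^ (4 * M + 2)) * (1 - q ^ (4 * M + 4)) * thetaCoeff q (M + 1) n =
      (1 + q ^ (4 * M + 2)) * thetaCoeff q M n +
        q ^ (2 * M + 1) * (thetaCoeff q M (n - 1) + thetaCoeff q M (n + 1)) := by
  have hQ0 : 0 < q ^ 2 := by positivity
  have hQ1 : q ^ 2 < 1 := pow_lt_one₀ h0.le h1 two_ne_zero
  have step := invQFactorial_step hQ0 hQ1
  have a1 := step (M + n)
  have a2 := step (M + n - 1)
  have b1 := step (M - n)
  have b2 := step (M - n - 1)
  rw [sub_add_cancel] at a2 b2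
  rw [a1] at a2
  rw [b1] at b2
  have hq := h0.ne'
  simp only [thetaCoeff, Nat.cast_add, Nat.cast_one]
  rw [show (M : ℤ) + 1 + n = M + n + 1 by ring, show (M : ℤ) + 1 - n = M - n + 1 by ring,
    show (M : ℤ) + (n - 1) = M + n - 1 by ring, show (M : ℤ) - (n - 1) = M - n + 1 by ring,
    show (M : ℤ) + (n + 1) = M + n + 1 by ring, show (M : ℤ) - (n + 1) = M - n - 1 by ring,
    a2, b2, a1, b1]
  have e1 : q ^ ((n - 1) ^ 2) = q ^ (n ^ 2) * (q ^ n * q ^ n)⁻¹ * q := by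
    rw [show (n - 1) ^ 2 = n ^ 2 - (n + n) + 1 by ring, zpow_add₀ hq, zpow_sub₀ hq,
      zpow_add₀ hq, zpow_one, div_eq_mul_inv]
  have e2 : q ^ ((n + 1) ^ 2) = q ^ (n ^ 2) * (q ^ n * q ^ n) * q := by
    rw [show (n + 1) ^ 2 = n ^ 2 + (n + n) + 1 by ring, zpow_add₀ hq, zpow_add₀ hq,
      zpow_add₀ hq, zpow_one]
  have hs : q ^ n ≠ 0 := (zpow_pos h0 n).ne'
  have f1 : (q ^ 2 : ℝ) ^ ((M : ℤ) + n) = (q ^ M) ^ 2 * (q ^ n) ^ 2 := by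
    rw [zpow_add₀ hQ0.ne', zpow_natCast, ← pow_mul, ← pow_mul, mul_comm 2 M]
    congr 1
    rw [← zpow_natCast, ← zpow_mul, ← zpow_natCast (q ^ n), ← zpow_mul, mul_comm]
  have f2 : (q ^ 2 : ℝ) ^ ((M : ℤ) - n) = (q ^ M) ^ 2 * ((q ^ n) ^ 2)⁻¹ := by
    rw [zpow_sub₀ hQ0.ne', zpow_natCast, ← pow_mul, ← pow_mul, mul_comm 2 M, div_eq_mul_inv]
    congr 2
    rw [← zpow_natCast, ← zpow_mul, ← zpow_natCast (q ^ n), ← zpow_mul, mul_comm]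
  rw [e1, e2, zpow_add_one₀ hQ0.ne', zpow_add_one₀ hQ0.ne', f1, f2]
  rw [show q ^ (4 * M + 2) = (q ^ M) ^ 4 * q ^ 2 by ring,
    show q ^ (4 * M + 4) = (q ^ M) ^ 4 * q ^ 4 by ring,
    show q ^ (2 * M + 1) = (q ^ M) ^ 2 * q by ring]
  generalize q ^ n = s at *
  generalize q ^ M = w at *
  field_simp
  ring

/-- The sequence `c` is arbitrary so that one recursion serves both T_n and its derivative n
U_{n-1}. -/
theorem tsum_thetaCoeff_succ {q : ℝ} (h0 : 0 < q) (h1 : q < 1) (M : ℕ) (c : ℤ → ℝ) :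
    (1 - q ^ (4 * M + 2)) * (1 - q ^ (4 * M + 4)) * ∑' n, thetaCoeff q (M + 1) n * c n =
      (1 + q ^ (4 * M + 2)) * ∑' n, thetaCoeff q M n * c n +
        q ^ (2 * M + 1) * ∑' n, thetaCoeff q M n * (c (n + 1) + c (n - 1)) := by
  have hs := summable_thetaCoeff_mul q M
  have s1 := (hs fun n => c (n + 1)).hasSum
  have s2 := (hs fun n => c (n - 1)).hasSum
  have t1 := (Equiv.subRight (1 : ℤ)).hasSum_iff.mpr s1
  have t2 := (Equiv.addRight (1 : ℤ)).hasSum_iff.mpr s2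
  have hsum := (((hs c).hasSum.mul_left (1 + q ^ (4 * M + 2))).add
    ((t1.add t2).mul_left (q ^ (2 * M + 1))))
  rw [← tsum_mul_left]
  simp only [mul_add (thetaCoeff q M _)]
  rw [((s1.add s2)).tsum_eq, ← hsum.tsum_eq]
  refine tsum_congr fun n => ?_
  rw [← mul_assoc, thetaCoeff_succ h0 h1]
  simp only [Function.comp, Equiv.subRight_apply, Equiv.coe_addRight, sub_add_cancel,
    add_sub_cancel_right]
  ring

-- With x = cos θ, the first sum is up to a positive constant the product of the factors 1 +
-- q^{4i+2} + 2 q^{2i+1} x. Each factor is nonnegative and increasing in x, hence so is the product.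
-- The second sum is its derivative in x, and the induction is the product rule.
open Polynomial Polynomial.Chebyshev in
theorem tsum_thetaCoeff_chebyshev_nonneg {q : ℝ} (h0 : 0 < q) (h1 : q < 1) {x : ℝ}
    (hx : |x| ≤ 1) (M : ℕ) :
    0 ≤ ∑' n, thetaCoeff q M n * (T ℝ n).eval x ∧
      0 ≤ ∑' n, thetaCoeff q M n * (n * (U ℝ (n - 1)).eval x) := by
  have hT : ∀ n : ℤ, (T ℝ (n + 1)).eval x + (T ℝ (n - 1)).eval x = 2 * x * (T ℝ n).eval x :=
    fun n => by
      have := congrArg (eval x) (T_add_one ℝ n)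
      simp only [eval_sub, eval_mul, eval_X, eval_ofNat] at this
      linarith
  -- This is the derivative in x of the recurrence `hT`, since T_n' = n U_{n-1}.
  have hU : ∀ n : ℤ, ((n + 1 : ℤ) : ℝ) * (U ℝ (n + 1 - 1)).eval x +
      ((n - 1 : ℤ) : ℝ) * (U ℝ (n - 1 - 1)).eval x =
      2 * x * (n * (U ℝ (n - 1)).eval x) + 2 * (T ℝ n).eval x := fun n => by
    have a := congrArg (eval x) (U_eq ℝ n)
    have b := congrArg (eval x) (two_mul_T_eq_U_sub_U ℝ (n - 2))
    simp only [eval_sub, eval_mul, eval_X, eval_ofNat, sub_add_cancel] at a b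
    rw [add_sub_cancel_right, show n - 1 - 1 = n - 2 by ring]
    push_cast
    linear_combination (n : ℝ) * a - b
  induction M with
  | zero =>
    have hz : ∀ c : ℤ → ℝ, ∑' n, thetaCoeff q 0 n * c n = c 0 := fun c => by
      rw [tsum_eq_single 0 fun n hn => by
        rw [thetaCoeff_eq_zero q (by simpa using hn), zero_mul]]
      simp [thetaCoeff, invQFactorial]
    rw [hz, hz]
    simp
  | succ M ih =>
    obtain ⟨ihT, ihU⟩ := ih
    have hpos : 0 < (1 - q ^ (4 * M + 2)) * (1 - q ^ (4 * M + 4)) :=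
      mul_pos (one_sub_pow_pos h0 h1 (by omega)) (one_sub_pow_pos h0 h1 (by omega))
    have hfac : 0 ≤ 1 + q ^ (4 * M + 2) + 2 * q ^ (2 * M + 1) * x := by
      have hd : 0 < q ^ (2 * M + 1) := by positivity
      rw [show q ^ (4 * M + 2) = (q ^ (2 * M + 1)) ^ 2 by ring]
      nlinarith [neg_le_of_abs_le hx, sq_nonneg (1 - q ^ (2 * M + 1))]
    have rT := tsum_thetaCoeff_succ h0 h1 M fun n => (T ℝ n).eval x
    have rU := tsum_thetaCoeff_succ h0 h1 M fun n => n * (U ℝ (n - 1)).eval x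
    simp only [hT] at rT
    simp only [hU, mul_add (thetaCoeff q M _)] at rU
    rw [Summable.tsum_add (summable_thetaCoeff_mul q M _) (summable_thetaCoeff_mul q M _)] at rU
    simp only [mul_left_comm (thetaCoeff q M _) (2 * x) _, mul_left_comm (thetaCoeff q M _) 2 _,
      tsum_mul_left] at rT rU
    refine ⟨nonneg_of_mul_nonneg_right ?_ hpos, nonneg_of_mul_nonneg_right ?_ hpos⟩
    · rw [rT]
      nlinarith [mul_nonneg hfac ihT]
    · rw [rU]
      have : 0 < q ^ (2 * M + 1) := by positivity
      nlinarith [mul_nonneg hfac ihU, mul_nonneg this.le ihT]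

/-! ### Passage from the finite triple product to the theta series -/

/-- The normalized coefficients of the finite triple product, without the Gaussian factor. -/
noncomputable def thetaRatio (q : ℝ) (M n : ℕ) : ℝ :=
  invQFactorial (q ^ 2) (M + n) * invQFactorial (q ^ 2) (M - n) / invQFactorial (q ^ 2) M ^ 2

theorem thetaRatio_succ {q : ℝ} (h0 : 0 < q) (h1 : q < 1) {M n : ℕ} (hn : n ≤ M) :
    thetaRatio q M (n + 1) =
      thetaRatio q M n * ((1 - (q ^ 2) ^ (M - n)) / (1 - (q ^ 2) ^ (M + n + 1))) := by
  have hQ0 : 0 < q ^ 2 := by positivity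
  have hQ1 : q ^ 2 < 1 := pow_lt_one₀ h0.le h1 two_ne_zero
  have a := invQFactorial_step hQ0 hQ1 (M + n)
  have b := invQFactorial_step hQ0 hQ1 (M - n - 1)
  rw [sub_add_cancel] at b
  have e1 : ∀ Q : ℝ, Q ^ ((M : ℤ) + n + 1) = Q ^ (M + n + 1) := fun Q => by
    exact_mod_cast zpow_natCast Q (M + n + 1)
  have e2 : (q ^ 2 : ℝ) ^ ((M : ℤ) - n) = (q ^ 2) ^ (M - n) := by
    rw [← Nat.cast_sub hn, zpow_natCast]
  have hp := (one_sub_pow_pos hQ0 hQ1 (M + n).succ_ne_zero).ne'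
  rw [e1] at a
  rw [e2] at b
  unfold thetaRatio
  rw [a]
  push_cast
  rw [show (M : ℤ) - (n + 1) = M - n - 1 by ring, ← add_assoc, b]
  rw [Nat.succ_eq_add_one] at hp
  field_simp

theorem thetaRatio_zero {q : ℝ} (h0 : 0 < q) (h1 : q < 1) (M : ℕ) : thetaRatio q M 0 = 1 := by
  have := (invQFactorial_pos (Q := q ^ 2) (by positivity) (pow_lt_one₀ h0.le h1 two_ne_zero)
    (Int.natCast_nonneg M)).ne'
  simp only [thetaRatio, Nat.cast_zero, add_zero, sub_zero]
  field_simp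

theorem thetaRatio_nonneg {q : ℝ} (h0 : 0 < q) (h1 : q < 1) (M n : ℕ) : 0 ≤ thetaRatio q M n := by
  have hQ0 : 0 < q ^ 2 := by positivity
  have hQ1 : q ^ 2 < 1 := pow_lt_one₀ h0.le h1 two_ne_zero
  exact div_nonneg (mul_nonneg (invQFactorial_nonneg hQ0 hQ1 _) (invQFactorial_nonneg hQ0 hQ1 _))
    (sq_nonneg _)

theorem thetaRatio_le_one {q : ℝ} (h0 : 0 < q) (h1 : q < 1) (M n : ℕ) : thetaRatio q M n ≤ 1 := by
  have hQ0 : 0 < q ^ 2 := by positivity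
  have hQ1 : q ^ 2 < 1 := pow_lt_one₀ h0.le h1 two_ne_zero
  induction n with
  | zero => exact (thetaRatio_zero h0 h1 M).le
  | succ n ih =>
    rcases lt_or_ge M (n + 1) with hM | hM
    · rw [thetaRatio, invQFactorial_of_neg _ (k := (M : ℤ) - (n + 1 : ℕ)) (by omega)]
      simp
    · rw [thetaRatio_succ h0 h1 (by omega)]
      refine mul_le_one₀ ih ?_ ?_
      · exact div_nonneg (sub_nonneg.mpr (pow_le_one₀ hQ0.le hQ1.le))
          (sub_nonneg.mpr (pow_le_one₀ hQ0.le hQ1.le))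
      · rw [div_le_one (one_sub_pow_pos hQ0 hQ1 (Nat.succ_ne_zero _))]
        exact sub_le_sub_left (pow_le_pow_of_le_one hQ0.le hQ1.le (by omega)) 1

theorem tendsto_thetaRatio {q : ℝ} (h0 : 0 < q) (h1 : q < 1) (n : ℕ) :
    Tendsto (fun M => thetaRatio q M n) atTop (𝓝 1) := by
  have hQ0 : 0 < q ^ 2 := by positivity
  have hQ1 : q ^ 2 < 1 := pow_lt_one₀ h0.le h1 two_ne_zero
  have hpow := tendsto_pow_atTop_nhds_zero_of_lt_one hQ0.le hQ1
  induction n with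
  | zero => simp only [thetaRatio_zero h0 h1]; exact tendsto_const_nhds
  | succ n ih =>
    have e : (fun M => thetaRatio q M n *
        ((1 - (q ^ 2) ^ (M - n)) / (1 - (q ^ 2) ^ (M + (n + 1))))) =ᶠ[atTop]
        fun M => thetaRatio q M (n + 1) := by
      filter_upwards [eventually_ge_atTop n] with M hM
      rw [thetaRatio_succ h0 h1 hM, add_assoc]
    refine Tendsto.congr' e ?_
    have t1 := hpow.comp (tendsto_sub_atTop_nat n)
    have t2 := hpow.comp (tendsto_add_atTop_nat (n + 1))
    have := ih.mul ((t1.const_sub 1).div (t2.const_sub 1) (by norm_num))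
    simpa [Function.comp_def] using this

-- The summand n U_{n-1} is even in n and vanishes at 0, so the sum over ℤ is twice the sum over ℕ.
open Polynomial Polynomial.Chebyshev in
theorem tsum_thetaRatio_nonneg {q : ℝ} (h0 : 0 < q) (h1 : q < 1) {x : ℝ} (hx : |x| ≤ 1) (M : ℕ) :
    0 ≤ ∑' n : ℕ, thetaRatio q M n * (q ^ (n ^ 2) * (n * (U ℝ (n - 1)).eval x)) := by
  have h := (tsum_thetaCoeff_chebyshev_nonneg h0 h1 hx M).2
  set c : ℤ → ℝ := fun n => thetaCoeff q M n * (n * (U ℝ (n - 1)).eval x) with hc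
  have hsum : Summable c := summable_thetaCoeff_mul q M _
  have hn : ∀ n : ℤ, c (-n) = c n := fun n => by
    simp only [hc]
    rw [thetaCoeff_neg, U_neg_sub_one]
    push_cast
    rw [eval_neg]; ring
  have s1 : Summable fun n : ℕ => c n := hsum.comp_injective Nat.cast_injective
  have hcz : c 0 = 0 := by simp [hc]
  have htot := (s1.hasSum.of_nat_of_neg (f := c) (by simpa only [hn] using s1.hasSum)).tsum_eq
  rw [htot, hcz, sub_zero, ← two_mul] at h
  have hM := invQFactorial_pos (Q := q ^ 2) (by positivity) (pow_lt_one₀ h0.le h1 two_ne_zero)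
    (Int.natCast_nonneg M)
  have heq : ∀ n : ℕ, thetaRatio q M n * (q ^ (n ^ 2) * (n * (U ℝ (n - 1)).eval x)) =
      (invQFactorial (q ^ 2) M ^ 2)⁻¹ * c n := fun n => by
    have : q ^ ((n : ℤ) ^ 2) = q ^ (n ^ 2) := by exact_mod_cast zpow_natCast q (n ^ 2)
    simp only [hc, thetaCoeff, thetaRatio, this]
    push_cast
    ring
  simp only [heq, tsum_mul_left]
  have : 0 ≤ ∑' n : ℕ, c n := by linarith
  positivity

-- Dominated convergence as M → ∞: the ratios lie in [0, 1] and tend to 1, and |U_{n-1}| ≤ n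
-- provides the summable bound.
open Polynomial Polynomial.Chebyshev in
theorem tsum_theta_nonneg {q : ℝ} (h0 : 0 < q) (h1 : q < 1) {x : ℝ} (hx : |x| ≤ 1)
    (hs : Summable fun n : ℕ => q ^ (n ^ 2) * (n : ℝ) ^ 2) :
    0 ≤ ∑' n : ℕ, q ^ (n ^ 2) * (n * (U ℝ (n - 1)).eval x) := by
  refine ge_of_tendsto' (x := atTop) (tendsto_tsum_of_dominated_convergence
    (f := fun M (n : ℕ) => thetaRatio q M n * (q ^ (n ^ 2) * (n * (U ℝ (n - 1)).eval x)))
    hs (fun n => ?_) (Eventually.of_forall fun M n => ?_))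
    (tsum_thetaRatio_nonneg h0 h1 hx)
  · simpa using (tendsto_thetaRatio h0 h1 n).mul_const _
  · have hb : ‖(U ℝ ((n : ℤ) - 1)).eval x‖ ≤ n := by
      cases n with
      | zero => simp
      | succ n => simpa using abs_eval_U_le hx n
    rw [norm_mul, Real.norm_of_nonneg (thetaRatio_nonneg h0 h1 M n), norm_mul, norm_mul,
      Real.norm_of_nonneg (by positivity : 0 ≤ q ^ (n ^ 2)), RCLike.norm_natCast, sq (n : ℝ)]
    calc _ ≤ 1 * (q ^ (n ^ 2) * (n * n)) := by
          gcongr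
          exact thetaRatio_le_one h0 h1 M n
      _ = _ := one_mul _

/-- Completing the square, j(j + 1) = ((m + 1)² - 1)/4, makes the heat kernel a theta series in q =
exp(-α/4), indexed by the dimension n = m + 1. -/
theorem heatWeight_eq (α : ℝ) (m : ℕ) :
    heatWeight α m = Real.exp (α / 4) * (Real.exp (-(α / 4)) ^ ((m + 1) ^ 2) * ((m + 1 : ℕ) : ℝ)) := by
  have h : -α * ((m : ℝ) / 2 * ((m : ℝ) / 2 + 1)) =
      α / 4 + ((m + 1) ^ 2 : ℕ) * -(α / 4) := by push_cast; ring
  rw [heatWeight, ← Real.exp_nat_mul, h, Real.exp_add]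
  push_cast
  ring

theorem heatKernel_nonneg {α : ℝ} (hα : 0 < α) {A : Matrix (Fin 2) (Fin 2) ℂ}
    (hA : |A.trace.re / 2| ≤ 1) : 0 ≤ heatKernel α A := by
  have h1 : Real.exp (-(α / 4)) < 1 := by rw [Real.exp_lt_one_iff]; linarith
  have hs : Summable fun n : ℕ => Real.exp (-(α / 4)) ^ (n ^ 2) * (n : ℝ) ^ 2 := by
    rw [← summable_nat_add_iff 1]
    refine ((summable_heatWeight_mul hα).mul_left (Real.exp (α / 4))⁻¹).congr fun m => ?_
    rw [heatWeight_eq]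
    push_cast
    field_simp
  have h := tsum_theta_nonneg (Real.exp_pos _) h1 hA hs
  have hs' : Summable fun n : ℕ => Real.exp (-(α / 4)) ^ (n ^ 2) *
      (n * (Polynomial.Chebyshev.U ℝ (n - 1)).eval (A.trace.re / 2)) := by
    rw [← summable_nat_add_iff 1]
    refine ((Summable.of_norm_bounded (summable_heatWeight_mul hα)
      (norm_heatTerm_le hA α)).mul_left (Real.exp (α / 4))⁻¹).congr fun m => ?_
    rw [heatWeight_eq, su2Character]
    push_cast
    rw [add_sub_cancel_right]
    field_simp
  rw [hs'.tsum_eq_zero_add] at h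
  simp only [Nat.cast_zero, zero_mul, mul_zero, zero_add] at h
  rw [heatKernel_eq_tsum]
  have e : ∀ m : ℕ, heatWeight α m * su2Character m A = Real.exp (α / 4) *
      (Real.exp (-(α / 4)) ^ ((m + 1) ^ 2) * (((m + 1 : ℕ) : ℝ) *
        (Polynomial.Chebyshev.U ℝ (((m + 1 : ℕ) : ℤ) - 1)).eval (A.trace.re / 2))) := fun m => by
    rw [heatWeight_eq, su2Character]
    push_cast
    rw [add_sub_cancel_right]
    ring
  simp only [e, tsum_mul_left]
  exact mul_nonneg (Real.exp_pos _).le h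

/-! ## The regularized delta functions -/

theorem heatKernel_congr {A B : Matrix (Fin 2) (Fin 2) ℂ} (h : A.trace.re = B.trace.re) (α : ℝ) :
    heatKernel α A = heatKernel α B := by
  simp only [heatKernel, su2Character, h]

/-- The central elements `±1` of `SU(2)`. -/
noncomputable def centralSU2 (z : ℤˣ) : SU2 :=
  ⟨z • (1 : Matrix (Fin 2) (Fin 2) ℂ), by
    rw [Matrix.mem_specialUnitaryGroup_iff, Matrix.mem_unitaryGroup_iff]
    rcases Int.units_eq_one_or z with rfl | rfl
    · simp
    · simp [Units.smul_def, Matrix.det_neg]⟩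

theorem coe_centralSU2_mul (z : ℤˣ) (g : SU2) :
    ((centralSU2 z * g : SU2) : Matrix (Fin 2) (Fin 2) ℂ) = z • (g : Matrix (Fin 2) (Fin 2) ℂ) := by
  simp [centralSU2]

theorem deltaReg_eq (α : ℝ) (z : ℤˣ × ℤˣ) (g : GaugeGroup) :
    deltaReg α z g =
      heatKernel α (centralSU2 z.1 * g.1 : SU2) * heatKernel α (centralSU2 z.2 * g.2 : SU2) := by
  rw [deltaReg, coe_centralSU2_mul, coe_centralSU2_mul]

theorem trace_re_units_smul (z : ℤˣ) (A : Matrix (Fin 2) (Fin 2) ℂ) :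
    (z • A).trace.re = (z : ℤ) * A.trace.re := by
  rw [Units.smul_def, Matrix.trace_smul, zsmul_eq_mul]
  simp

theorem deltaReg_congr {g h : GaugeGroup}
    (h1 : (g.1 : Matrix (Fin 2) (Fin 2) ℂ).trace.re = (h.1 : Matrix (Fin 2) (Fin 2) ℂ).trace.re)
    (h2 : (g.2 : Matrix (Fin 2) (Fin 2) ℂ).trace.re = (h.2 : Matrix (Fin 2) (Fin 2) ℂ).trace.re)
    (α : ℝ) (z : ℤˣ × ℤˣ) : deltaReg α z g = deltaReg α z h := by
  rw [deltaReg, deltaReg]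
  congr 1 <;> exact heatKernel_congr (by rw [trace_re_units_smul, trace_re_units_smul]; simp [*]) α

theorem deltaRegMod_mul_comm (Z : Subgroup (ℤˣ × ℤˣ)) (α : ℝ) (a b : GaugeGroup) :
    deltaRegMod Z α (a * b) = deltaRegMod Z α (b * a) := by
  simp only [deltaRegMod]
  congr 1
  refine Finset.sum_congr rfl fun z _ => deltaReg_congr ?_ ?_ α z
  · exact congrArg Complex.re (Matrix.trace_mul_comm (a.1 : Matrix (Fin 2) (Fin 2) ℂ) b.1)
  · exact congrArg Complex.re (Matrix.trace_mul_comm (a.2 : Matrix (Fin 2) (Fin 2) ℂ) b.2)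

theorem SU2.trace_re_inv (g : SU2) :
    ((g⁻¹ : SU2) : Matrix (Fin 2) (Fin 2) ℂ).trace.re =
      (g : Matrix (Fin 2) (Fin 2) ℂ).trace.re := by
  change (star (g : Matrix (Fin 2) (Fin 2) ℂ)).trace.re = _
  rw [Matrix.star_eq_conjTranspose, Matrix.trace_conjTranspose]
  simp

theorem deltaRegMod_inv (Z : Subgroup (ℤˣ × ℤˣ)) (α : ℝ) (a : GaugeGroup) :
    deltaRegMod Z α a⁻¹ = deltaRegMod Z α a := by
  simp only [deltaRegMod]
  congr 1
  exact Finset.sum_congr rfl fun z _ =>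
    deltaReg_congr (g := a⁻¹) (h := a) (SU2.trace_re_inv a.1) (SU2.trace_re_inv a.2) α z

theorem deltaRegOne_eq (α : ℝ) : deltaRegOne α = heatKernel α 1 * heatKernel α 1 := by
  simp [deltaRegOne, deltaReg]

theorem deltaRegOne_pos {α : ℝ} (hα : 0 < α) : 0 < deltaRegOne α := by
  rw [deltaRegOne_eq]; exact mul_pos (heatKernel_one_pos hα) (heatKernel_one_pos hα)

theorem tendsto_deltaRegOne : Tendsto deltaRegOne (𝓝[>] 0) atTop := by
  simp only [funext deltaRegOne_eq]
  exact tendsto_heatKernel_one.atTop_mul_atTop₀ tendsto_heatKernel_one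

theorem deltaReg_nonneg {α : ℝ} (hα : 0 < α) (z : ℤˣ × ℤˣ) (g : GaugeGroup) :
    0 ≤ deltaReg α z g := by
  rw [deltaReg_eq]
  exact mul_nonneg (heatKernel_nonneg hα (SU2.abs_trace_re_div_two_le _))
    (heatKernel_nonneg hα (SU2.abs_trace_re_div_two_le _))

theorem deltaReg_le {α : ℝ} (hα : 0 < α) (z : ℤˣ × ℤˣ) (g : GaugeGroup) :
    deltaReg α z g ≤ deltaRegOne α := by
  rw [deltaReg_eq, deltaRegOne_eq]
  exact mul_le_mul ((le_abs_self _).trans (abs_heatKernel_le hα (SU2.abs_trace_re_div_two_le _)))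
    ((le_abs_self _).trans (abs_heatKernel_le hα (SU2.abs_trace_re_div_two_le _)))
    (heatKernel_nonneg hα (SU2.abs_trace_re_div_two_le _)) (heatKernel_one_pos hα).le

/-! ### The average of the delta function over the central subgroup -/

open Classical in
theorem card_filter_mem_eq (Z : Subgroup (ℤˣ × ℤˣ)) :
    ((Finset.univ.filter (· ∈ Z)).card : ℝ) = Nat.card Z := by
  rw [Nat.card_eq_fintype_card, Fintype.card_subtype]

theorem natCard_subgroup_pos (Z : Subgroup (ℤˣ × ℤˣ)) : (0 : ℝ) < Nat.card Z := by
  exact_mod_cast Nat.card_pos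

theorem deltaRegMod_nonneg (Z : Subgroup (ℤˣ × ℤˣ)) {α : ℝ} (hα : 0 < α) (g : GaugeGroup) :
    0 ≤ deltaRegMod Z α g :=
  div_nonneg (Finset.sum_nonneg fun z _ => deltaReg_nonneg hα z g) (Nat.cast_nonneg _)

theorem deltaRegMod_le (Z : Subgroup (ℤˣ × ℤˣ)) {α : ℝ} (hα : 0 < α) (g : GaugeGroup) :
    deltaRegMod Z α g ≤ deltaRegOne α := by
  classical
  rw [deltaRegMod, div_le_iff₀ (natCard_subgroup_pos Z), ← card_filter_mem_eq, mul_comm,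
    ← nsmul_eq_mul]
  exact Finset.sum_le_card_nsmul _ _ _ fun z _ => deltaReg_le hα z g

theorem continuous_deltaReg {α : ℝ} (hα : 0 < α) (z : ℤˣ × ℤˣ) : Continuous (deltaReg α z) := by
  simp only [funext (deltaReg_eq α z)]
  have h := continuous_heatKernel hα
  exact (h.comp (continuous_const.mul continuous_fst)).mul
    (h.comp (continuous_const.mul continuous_snd))

theorem continuous_deltaRegMod (Z : Subgroup (ℤˣ × ℤˣ)) {α : ℝ} (hα : 0 < α) :
    Continuous (deltaRegMod Z α) :=
  (continuous_finsetSum _ fun z _ => continuous_deltaReg hα z).div_const _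

theorem integral_deltaReg {α : ℝ} (hα : 0 < α) (z : ℤˣ × ℤˣ) :
    ∫ g, deltaReg α z g ∂gaugeHaar = 1 := by
  simp only [deltaReg_eq, gaugeHaar]
  rw [integral_prod_mul (fun g : SU2 => heatKernel α (centralSU2 z.1 * g : SU2))
    (fun g : SU2 => heatKernel α (centralSU2 z.2 * g : SU2)),
    integral_mul_left_eq_self (μ := su2Haar) (fun g : SU2 => heatKernel α g),
    integral_mul_left_eq_self (μ := su2Haar) (fun g : SU2 => heatKernel α g),
    integral_heatKernel hα, one_mul]

theorem integrable_of_continuous_gaugeGroup {f : GaugeGroup → ℝ} (hf : Continuous f) :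
    Integrable f gaugeHaar :=
  hf.integrable_of_hasCompactSupport (HasCompactSupport.of_compactSpace f)

theorem integral_deltaRegMod (Z : Subgroup (ℤˣ × ℤˣ)) {α : ℝ} (hα : 0 < α) :
    ∫ g, deltaRegMod Z α g ∂gaugeHaar = 1 := by
  classical
  simp only [deltaRegMod]
  rw [integral_div, integral_finsetSum _ fun z _ =>
    integrable_of_continuous_gaugeGroup (continuous_deltaReg hα z)]
  simp only [integral_deltaReg hα, Finset.sum_const, nsmul_eq_mul, mul_one]
  rw [div_eq_one_iff_eq (natCard_subgroup_pos Z).ne', ← card_filter_mem_eq]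

theorem lintegral_enorm_deltaRegMod (Z : Subgroup (ℤˣ × ℤˣ)) {α : ℝ} (hα : 0 < α) :
    ∫⁻ g, ‖deltaRegMod Z α g‖ₑ ∂gaugeHaar = 1 := by
  simp only [Real.enorm_of_nonneg (deltaRegMod_nonneg Z hα _)]
  rw [← ofReal_integral_eq_lintegral_ofReal
    (integrable_of_continuous_gaugeGroup (continuous_deltaRegMod Z hα))
    (Eventually.of_forall (deltaRegMod_nonneg Z hα)), integral_deltaRegMod Z hα,
    ENNReal.ofReal_one]

/-! ## Parallel transports at the nodes -/

namespace ColoredGraph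

section Paths

variable {n : ℕ} {W B : Type*}

/-- The white end of the line of color `ℓ` at a node. -/
def whiteEnd (Γ : ColoredGraph n W B) (ℓ : Fin n) : W ⊕ B → W := Sum.elim id (Γ.line ℓ).symm

theorem whiteEnd_eq_iff (Γ : ColoredGraph n W B) (ℓ : Fin n) (v : W ⊕ B) (w : W) :
    Γ.whiteEnd ℓ v = w ↔ v = Sum.inl w ∨ v = Sum.inr (Γ.line ℓ w) := by
  cases v with
  | inl w' => simp [whiteEnd]
  | inr b => simp [whiteEnd, Equiv.symm_apply_eq]

theorem exists_line_of_adj {Γ : ColoredGraph n W B} {S : Finset (Fin n)} {x y : W ⊕ B}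
    (h : (Γ.colorSubgraph S).Adj x y) : ∃ ℓ ∈ S, ∃ w,
      x = Sum.inl w ∧ y = Sum.inr (Γ.line ℓ w) ∨ y = Sum.inl w ∧ x = Sum.inr (Γ.line ℓ w) := by
  rw [colorSubgraph, SimpleGraph.fromRel_adj] at h
  rcases h.2 with ⟨w, ℓ, hℓ, h1, h2⟩ | ⟨w, ℓ, hℓ, h1, h2⟩
  · exact ⟨ℓ, hℓ, w, Or.inl ⟨h1, h2⟩⟩
  · exact ⟨ℓ, hℓ, w, Or.inr ⟨h1, h2⟩⟩

theorem adj_of_line {Γ : ColoredGraph n W B} {S : Finset (Fin n)} {x y : W ⊕ B} {ℓ : Fin n}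
    (hℓ : ℓ ∈ S) {w : W}
    (h : x = Sum.inl w ∧ y = Sum.inr (Γ.line ℓ w) ∨ y = Sum.inl w ∧ x = Sum.inr (Γ.line ℓ w)) :
    (Γ.colorSubgraph S).Adj x y := by
  rw [colorSubgraph, SimpleGraph.fromRel_adj]
  rcases h with ⟨rfl, rfl⟩ | ⟨rfl, rfl⟩
  · exact ⟨by simp, Or.inl ⟨w, ℓ, hℓ, rfl, rfl⟩⟩
  · exact ⟨by simp, Or.inr ⟨w, ℓ, hℓ, rfl, rfl⟩⟩

open Classical in
/-- A path in a face, as a set of lines: modulo 2 its boundary consists of its two ends. -/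
theorem exists_chain (Γ : ColoredGraph n W B) {a b : Fin n} {u s : W ⊕ B}
    (h : (Γ.colorSubgraph {a, b}).Reachable u s) :
    ∃ p q : W → ZMod 2, ∀ v, p (Γ.whiteEnd a v) + q (Γ.whiteEnd b v) =
      (if v = u then 1 else 0) + (if v = s then 1 else 0) := by
  obtain ⟨walk⟩ := h
  induction walk with
  | nil =>
    refine ⟨0, 0, fun v => ?_⟩
    split_ifs
    · simp only [Pi.zero_apply]; decide
    · simp
  | @cons u u' s hadj _ ih =>
    obtain ⟨p, q, hpq⟩ := ih
    obtain ⟨ℓ, hℓ, w, hw⟩ := exists_line_of_adj hadj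
    have hind : ∀ v, (if Γ.whiteEnd ℓ v = w then (1 : ZMod 2) else 0) =
        (if v = u then 1 else 0) + (if v = u' then 1 else 0) := fun v => by
      simp only [whiteEnd_eq_iff]
      rcases hw with ⟨rfl, rfl⟩ | ⟨rfl, rfl⟩ <;> by_cases h1 : v = Sum.inl w <;>
        by_cases h2 : v = Sum.inr (Γ.line ℓ w) <;> simp_all
    have h2 : (2 : ZMod 2) = 0 := rfl
    rcases Finset.mem_insert.mp hℓ with rfl | hℓ
    · refine ⟨fun x => p x + if x = w then 1 else 0, q, fun v => ?_⟩
      have := hind v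
      dsimp only
      linear_combination hpq v + this + (if v = u' then (1 : ZMod 2) else 0) * h2
    · rw [Finset.mem_singleton] at hℓ
      subst hℓ
      refine ⟨p, fun x => q x + if x = w then 1 else 0, fun v => ?_⟩
      have := hind v
      dsimp only
      linear_combination hpq v + this + (if v = u' then (1 : ZMod 2) else 0) * h2

/-- For a pair of colors `a`, `b` whose face at `u` meets `S`, a set of line variables `(ℓ, w, j)`
that separates, among the pairs of line variables glued at the nodes outside `S`, only the pair
of colors `a`, `b` at `u`. -/
theorem exists_separating (Γ : ColoredGraph n W B) {a b : Fin n} (hab : a ≠ b)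
    {S : Set (W ⊕ B)} {u s : W ⊕ B} (hu : u ∉ S) (hs : s ∈ S)
    (h : (Γ.colorSubgraph {a, b}).Reachable u s) :
    ∃ E : Set (Fin n × W × Fin n),
      (∀ v ∉ S, ∀ i j, (v ≠ u ∨ ¬(i = a ∧ j = b ∨ i = b ∧ j = a)) →
        ((i, Γ.whiteEnd i v, j) ∈ E ↔ (j, Γ.whiteEnd j v, i) ∈ E)) ∧
      ¬((a, Γ.whiteEnd a u, b) ∈ E ↔ (b, Γ.whiteEnd b u, a) ∈ E) := by
  classical
  obtain ⟨p, q, hpq⟩ := Γ.exists_chain h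
  have z2 : ∀ x y : ZMod 2, x + y = 0 → (x = 1 ↔ y = 1) := by decide
  have z2' : ∀ x y : ZMod 2, x + y = 1 → ¬(x = 1 ↔ y = 1) := by decide
  -- These are the (a, b) variables on the lines of the chain. An even boundary at v means that both
  -- or neither of the two glued variables are chosen; the parity is odd only at u and at s, and s
  -- belongs to S.
  refine ⟨{e | e.1 = a ∧ e.2.2 = b ∧ p e.2.1 = 1 ∨ e.1 = b ∧ e.2.2 = a ∧ q e.2.1 = 1}, ?_, ?_⟩
  · intro v hv i j hij
    have hvs : v ≠ s := fun h => hv (h ▸ hs)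
    simp only [Set.mem_ofPred_eq]
    by_cases h1 : i = a ∧ j = b
    · obtain ⟨rfl, rfl⟩ := h1
      have hvu : v ≠ u := by tauto
      have := z2 _ _ ((hpq v).trans (by simp [hvu, hvs]))
      simp [hab, hab.symm, this]
    · by_cases h2 : i = b ∧ j = a
      · obtain ⟨rfl, rfl⟩ := h2
        have hvu : v ≠ u := by tauto
        have := z2 _ _ ((hpq v).trans (by simp [hvu, hvs]))
        simp [hab, hab.symm, this]
      · tauto
  · have hus : u ≠ s := fun h => hu (h ▸ hs)
    have := z2' _ _ ((hpq u).trans (by simp [hus]))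
    simpa [hab, hab.symm] using this

end Paths

variable {W B : Type*}

/-- The transport between the lines of colors `i` and `j` at the node `v`. -/
def transport (Γ : ColoredGraph 5 W B) (v : W ⊕ B) (i j : Fin 5)
    (g : Fin 5 × W × Fin 5 → GaugeGroup) : GaugeGroup :=
  g (i, Γ.whiteEnd i v, j) * (g (j, Γ.whiteEnd j v, i))⁻¹

theorem transport_inv (Γ : ColoredGraph 5 W B) (v : W ⊕ B) (i j : Fin 5)
    (g : Fin 5 × W × Fin 5 → GaugeGroup) : (Γ.transport v i j g)⁻¹ = Γ.transport v j i g := by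
  simp [transport]

theorem measurable_transport (Γ : ColoredGraph 5 W B) (v : W ⊕ B) (i j : Fin 5) :
    Measurable (Γ.transport v i j) :=
  (measurable_pi_apply _).mul (measurable_pi_apply _).inv

/-- The weight `f` of the holonomy around three lines at the node `v`. -/
def tripleWeight (Γ : ColoredGraph 5 W B) (f : GaugeGroup → ENNReal) (v : W ⊕ B) (i j k : Fin 5)
    (g : Fin 5 × W × Fin 5 → GaugeGroup) : ENNReal :=
  f (Γ.transport v i j g * Γ.transport v j k g * Γ.transport v k i g)

theorem measurable_tripleWeight (Γ : ColoredGraph 5 W B) {f : GaugeGroup → ENNReal}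
    (hf : Measurable f) (v : W ⊕ B) (i j k : Fin 5) : Measurable (Γ.tripleWeight f v i j k) :=
  hf.comp (((Γ.measurable_transport v i j).mul (Γ.measurable_transport v j k)).mul
    (Γ.measurable_transport v k i))

theorem tripleWeight_rotate (Γ : ColoredGraph 5 W B) {f : GaugeGroup → ENNReal}
    (hcomm : ∀ a b, f (a * b) = f (b * a)) (v : W ⊕ B) (i j k : Fin 5) :
    Γ.tripleWeight f v i j k = Γ.tripleWeight f v j k i := by
  funext g
  simp only [tripleWeight]
  rw [mul_assoc, hcomm]

theorem tripleWeight_reverse (Γ : ColoredGraph 5 W B) {f : GaugeGroup → ENNReal}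
    (hinv : ∀ a, f a⁻¹ = f a) (v : W ⊕ B) (i j k : Fin 5) :
    Γ.tripleWeight f v i j k = Γ.tripleWeight f v i k j := by
  funext g
  simp only [tripleWeight]
  rw [← hinv, mul_inv_rev, mul_inv_rev, transport_inv, transport_inv, transport_inv, mul_assoc]

/-- A cyclic rotation of the six factors regroups the edge variables, each living on one line, into
transports, each joining two lines. -/
theorem holonomy_weight (Γ : ColoredGraph 5 W B) {f : GaugeGroup → ENNReal}
    (hcomm : ∀ a b, f (a * b) = f (b * a)) (v : W ⊕ B) (i j k : Fin 5)
    (g : Fin 5 × W × Fin 5 → GaugeGroup) :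
    f (holonomy (fun ℓ m => g (ℓ, Γ.whiteEnd ℓ v, m)) i j k) = Γ.tripleWeight f v j i k g := by
  simp only [holonomy, edgeVar, tripleWeight, transport]
  rw [← mul_assoc _ _ (g (j, Γ.whiteEnd j v, i)), hcomm]
  simp only [mul_assoc]

/-! ## Integration of one holonomy weight -/

open Classical in
/-- Right multiplication by `h` of the variables in `E`. -/
noncomputable def shift (E : Set (Fin 5 × W × Fin 5)) (h : GaugeGroup)
    (g : Fin 5 × W × Fin 5 → GaugeGroup) : Fin 5 × W × Fin 5 → GaugeGroup :=
  fun e => g e * if e ∈ E then h else 1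

theorem transport_shift_eq (Γ : ColoredGraph 5 W B) {E : Set (Fin 5 × W × Fin 5)} {v : W ⊕ B}
    {i j : Fin 5} (hE : (i, Γ.whiteEnd i v, j) ∈ E ↔ (j, Γ.whiteEnd j v, i) ∈ E)
    (h : GaugeGroup) (g : Fin 5 × W × Fin 5 → GaugeGroup) :
    Γ.transport v i j (shift E h g) = Γ.transport v i j g := by
  by_cases he : (i, Γ.whiteEnd i v, j) ∈ E
  · simp [transport, shift, he, hE.mp he]
  · simp [transport, shift, he, mt hE.mpr he]

theorem measurable_shift (E : Set (Fin 5 × W × Fin 5)) :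
    Measurable fun x : GaugeGroup × (Fin 5 × W × Fin 5 → GaugeGroup) => shift E x.1 x.2 := by
  refine measurable_pi_lambda _ fun e => ?_
  simp only [shift]
  split_ifs
  · exact ((measurable_pi_apply e).comp measurable_snd).mul measurable_fst
  · exact ((measurable_pi_apply e).comp measurable_snd).mul measurable_const

/-- A function of the transports at the nodes outside `S`, other than the transport between the
colors `σ a` and `σ b` at `u`. -/
def IsLocalOff (Γ : ColoredGraph 5 W B) (σ : Equiv.Perm (Fin 5)) (S : Set (W ⊕ B)) (u : W ⊕ B)
    (a b : Fin 5) (F : (Fin 5 × W × Fin 5 → GaugeGroup) → ENNReal) : Prop :=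
  ∀ g g', (∀ v ∉ S, ∀ i j, (v ≠ u ∨ ¬(i = a ∧ j = b ∨ i = b ∧ j = a)) →
    Γ.transport v (σ i) (σ j) g = Γ.transport v (σ i) (σ j) g') → F g = F g'

theorem IsLocalOff.mul {Γ : ColoredGraph 5 W B} {σ : Equiv.Perm (Fin 5)} {S : Set (W ⊕ B)}
    {u : W ⊕ B} {a b : Fin 5} {F F' : (Fin 5 × W × Fin 5 → GaugeGroup) → ENNReal}
    (hF : Γ.IsLocalOff σ S u a b F) (hF' : Γ.IsLocalOff σ S u a b F') :
    Γ.IsLocalOff σ S u a b (fun g => F g * F' g) := fun g g' h => by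
  simp only [hF g g' h, hF' g g' h]

theorem IsLocalOff.prod {Γ : ColoredGraph 5 W B} {σ : Equiv.Perm (Fin 5)} {S : Set (W ⊕ B)}
    {u : W ⊕ B} {a b : Fin 5} {ι : Type*} {s : Finset ι}
    {F : ι → (Fin 5 × W × Fin 5 → GaugeGroup) → ENNReal}
    (hF : ∀ i ∈ s, Γ.IsLocalOff σ S u a b (F i)) :
    Γ.IsLocalOff σ S u a b (fun g => ∏ i ∈ s, F i g) := fun g g' h =>
  Finset.prod_congr rfl fun i hi => hF i hi g g' h

theorem isLocalOff_tripleWeight (Γ : ColoredGraph 5 W B) (f : GaugeGroup → ENNReal)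
    {σ : Equiv.Perm (Fin 5)} {S : Set (W ⊕ B)} {u v : W ⊕ B} {a b i j k : Fin 5} (hv : v ∉ S)
    (h : v ≠ u ∨ (a ≠ i ∧ a ≠ j ∧ a ≠ k) ∨ (b ≠ i ∧ b ≠ j ∧ b ≠ k)) :
    Γ.IsLocalOff σ S u a b (Γ.tripleWeight f v (σ i) (σ j) (σ k)) := fun g g' hg => by
  simp only [tripleWeight]
  rw [hg v hv i j (by tauto), hg v hv j k (by tauto), hg v hv k i (by tauto)]

variable [Fintype W]

/-- The product Haar measure on the line variables. -/
noncomputable def lineMeasure (W : Type*) [Fintype W] :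
    Measure (Fin 5 × W × Fin 5 → GaugeGroup) := Measure.pi fun _ => gaugeHaar

instance : IsProbabilityMeasure (lineMeasure W) := by unfold lineMeasure; infer_instance

theorem measurePreserving_shift (E : Set (Fin 5 × W × Fin 5)) (h : GaugeGroup) :
    MeasurePreserving (shift E h) (lineMeasure W) (lineMeasure W) := by
  classical
  exact measurePreserving_pi (fun _ => gaugeHaar) (fun _ => gaugeHaar)
    (f := fun e (x : GaugeGroup) => x * if e ∈ E then h else 1)
    fun e => measurePreserving_mul_right gaugeHaar _

/-- The shift preserves the measure, so the integral may be averaged over h; by Tonelli this average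
acts on φ alone. -/
theorem lintegral_mul_shift (E : Set (Fin 5 × W × Fin 5))
    {F φ : (Fin 5 × W × Fin 5 → GaugeGroup) → ENNReal} (hF : Measurable F) (hφ : Measurable φ)
    (hFE : ∀ h g, F (shift E h g) = F g)
    (hφE : ∀ g, ∫⁻ h, φ (shift E h g) ∂gaugeHaar = 1) :
    ∫⁻ g, F g * φ g ∂lineMeasure W = ∫⁻ g, F g ∂lineMeasure W := by
  have hm : Measurable fun x : GaugeGroup × (Fin 5 × W × Fin 5 → GaugeGroup) =>
      F x.2 * φ (shift E x.1 x.2) :=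
    (hF.comp measurable_snd).mul (hφ.comp (measurable_shift E))
  calc ∫⁻ g, F g * φ g ∂lineMeasure W
      = ∫⁻ _ : GaugeGroup, ∫⁻ g, F g * φ g ∂lineMeasure W ∂gaugeHaar := by simp
    _ = ∫⁻ h, ∫⁻ g, F g * φ (shift E h g) ∂lineMeasure W ∂gaugeHaar := by
        refine lintegral_congr fun h => ?_
        have := (measurePreserving_shift E h).lintegral_comp (hF.mul hφ)
        simpa only [Pi.mul_apply, hFE] using this.symm
    _ = ∫⁻ g, ∫⁻ h, F g * φ (shift E h g) ∂gaugeHaar ∂lineMeasure W :=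
        lintegral_lintegral_swap hm.aemeasurable
    _ = ∫⁻ g, F g ∂lineMeasure W := by
        refine lintegral_congr fun g => ?_
        have hmg : Measurable fun h => φ (shift E h g) :=
          hφ.comp ((measurable_shift E).comp (measurable_id.prodMk measurable_const))
        rw [lintegral_const_mul _ hmg, hφE, mul_one]

/-- The separating shift inserts h in the (a, b) transport at u and leaves everything else in the
integrand fixed, so the weight integrates to 1. -/
theorem lintegral_mul_tripleWeight (Γ : ColoredGraph 5 W B) {f : GaugeGroup → ENNReal}
    (hf : Measurable f) (hf1 : ∫⁻ h, f h ∂gaugeHaar = 1) {σ : Equiv.Perm (Fin 5)}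
    {S : Set (W ⊕ B)} {u s : W ⊕ B} (hu : u ∉ S) (hs : s ∈ S) {a b c : Fin 5} (hab : a ≠ b)
    (hac : a ≠ c) (hbc : b ≠ c) (h : (Γ.colorSubgraph {σ a, σ b}).Reachable u s)
    {F : (Fin 5 × W × Fin 5 → GaugeGroup) → ENNReal} (hF : Measurable F)
    (hloc : Γ.IsLocalOff σ S u a b F) :
    ∫⁻ g, F g * Γ.tripleWeight f u (σ a) (σ b) (σ c) g ∂lineMeasure W =
      ∫⁻ g, F g ∂lineMeasure W := by
  obtain ⟨E, hE, hEu⟩ := Γ.exists_separating (σ.injective.ne hab) hu hs h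
  have hE' : ∀ v ∉ S, ∀ i j, (v ≠ u ∨ ¬(i = a ∧ j = b ∨ i = b ∧ j = a)) → ∀ h g,
      Γ.transport v (σ i) (σ j) (shift E h g) = Γ.transport v (σ i) (σ j) g :=
    fun v hv i j hij h g => Γ.transport_shift_eq (hE v hv _ _ (by simpa using hij)) h g
  refine lintegral_mul_shift E hF (Γ.measurable_tripleWeight hf _ _ _ _)
    (fun h g => hloc _ _ fun v hv i j hij => hE' v hv i j hij h g) fun g => ?_
  have e1 := fun h => hE' u hu b c (by tauto) h g
  have e2 := fun h => hE' u hu c a (by tauto) h g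
  simp only [tripleWeight, e1, e2]
  rw [← hf1]
  -- Exactly one of the two variables of the transport is shifted; the transport receives h or h⁻¹
  -- accordingly, and Haar measure is invariant under inversion.
  by_cases hm : (σ a, Γ.whiteEnd (σ a) u, σ b) ∈ E
  · have hm' : (σ b, Γ.whiteEnd (σ b) u, σ a) ∉ E := by tauto
    rw [← lintegral_gaugeHaar_mul_mul (f := f) (g (σ a, Γ.whiteEnd (σ a) u, σ b))
      ((g (σ b, Γ.whiteEnd (σ b) u, σ a))⁻¹ * Γ.transport u (σ b) (σ c) g *
        Γ.transport u (σ c) (σ a) g)]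
    refine lintegral_congr fun h => congrArg f ?_
    rw [transport]
    simp only [shift, hm, hm', if_true, if_false, mul_one, mul_assoc]
  · have hm' : (σ b, Γ.whiteEnd (σ b) u, σ a) ∈ E := by tauto
    rw [← lintegral_gaugeHaar_mul_inv_mul (f := f) (g (σ a, Γ.whiteEnd (σ a) u, σ b))
      ((g (σ b, Γ.whiteEnd (σ b) u, σ a))⁻¹ * Γ.transport u (σ b) (σ c) g *
        Γ.transport u (σ c) (σ a) g)]
    refine lintegral_congr fun h => congrArg f ?_
    rw [transport]
    simp only [shift, hm, hm', if_true, if_false, mul_one, mul_assoc, mul_inv_rev]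

end ColoredGraph

/-! ## Successive integration of the nodes -/

namespace ColoredGraph

variable {W B : Type*}

theorem reachable_pair_of_adj {Γ : ColoredGraph 5 W B} {c : Fin 5} {u s : W ⊕ B}
    (h : (Γ.colorSubgraph {c}).Adj u s) {S : Finset (Fin 5)} (hc : c ∈ S) :
    (Γ.colorSubgraph S).Reachable u s := by
  obtain ⟨ℓ, hℓ, w, hw⟩ := exists_line_of_adj h
  rw [Finset.mem_singleton] at hℓ
  subst hℓ
  exact (adj_of_line hc hw).reachable

/-- The weights at a node of the triples `(k, k + 1, k + 3)`, which contain one pair of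
the jacket of `σ`. -/
def outerWeight (Γ : ColoredGraph 5 W B) (f : GaugeGroup → ENNReal) (σ : Equiv.Perm (Fin 5))
    (v : W ⊕ B) (k : Fin 5) : (Fin 5 × W × Fin 5 → GaugeGroup) → ENNReal :=
  Γ.tripleWeight f v (σ k) (σ (k + 1)) (σ (k + 3))

/-- The weights at a node of the triples `(k - 1, k, k + 1)`, which contain two pairs of
the jacket of `σ`. -/
def innerWeight (Γ : ColoredGraph 5 W B) (f : GaugeGroup → ENNReal) (σ : Equiv.Perm (Fin 5))
    (v : W ⊕ B) (k : Fin 5) : (Fin 5 × W × Fin 5 → GaugeGroup) → ENNReal :=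
  Γ.tripleWeight f v (σ (k - 1)) (σ k) (σ (k + 1))

/-- The ten weights at a node. -/
noncomputable def nodeWeight (Γ : ColoredGraph 5 W B) (f : GaugeGroup → ENNReal) (σ : Equiv.Perm (Fin 5))
    (v : W ⊕ B) (g : Fin 5 × W × Fin 5 → GaugeGroup) : ENNReal :=
  (∏ k, Γ.outerWeight f σ v k g) * ∏ k, Γ.innerWeight f σ v k g

theorem measurable_outerWeight (Γ : ColoredGraph 5 W B) {f : GaugeGroup → ENNReal}
    (hf : Measurable f) (σ : Equiv.Perm (Fin 5)) (v : W ⊕ B) (k : Fin 5) :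
    Measurable (Γ.outerWeight f σ v k) := Γ.measurable_tripleWeight hf _ _ _ _

theorem measurable_innerWeight (Γ : ColoredGraph 5 W B) {f : GaugeGroup → ENNReal}
    (hf : Measurable f) (σ : Equiv.Perm (Fin 5)) (v : W ⊕ B) (k : Fin 5) :
    Measurable (Γ.innerWeight f σ v k) := Γ.measurable_tripleWeight hf _ _ _ _

theorem measurable_nodeWeight (Γ : ColoredGraph 5 W B) {f : GaugeGroup → ENNReal}
    (hf : Measurable f) (σ : Equiv.Perm (Fin 5)) (v : W ⊕ B) :
    Measurable (Γ.nodeWeight f σ v) :=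
  (Finset.measurable_fun_prod _ fun k _ => Γ.measurable_outerWeight hf σ v k).mul
    (Finset.measurable_fun_prod _ fun k _ => Γ.measurable_innerWeight hf σ v k)

/-- The face of the `k`-th pair of consecutive colors at a node. -/
def jacketFace (Γ : ColoredGraph 5 W B) (σ : Equiv.Perm (Fin 5)) (k : Fin 5) (v : W ⊕ B) :
    Γ.Face {σ k, σ (k + 1)} :=
  (Γ.colorSubgraph {σ k, σ (k + 1)}).connectedComponentMk v

open Classical in
/-- The number of faces of the jacket that pass through `u` and avoid `S`. -/
noncomputable def numNewFaces (Γ : ColoredGraph 5 W B) (σ : Equiv.Perm (Fin 5))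
    (S : Finset (W ⊕ B)) (u : W ⊕ B) : ℕ :=
  (Finset.univ.filter fun k => ∀ s ∈ S, Γ.jacketFace σ k u ≠ Γ.jacketFace σ k s).card

theorem prod_innerWeight_le (Γ : ColoredGraph 5 W B) {f : GaugeGroup → ENNReal} {D : ENNReal}
    (hD : ∀ a, f a ≤ D) (σ : Equiv.Perm (Fin 5)) (u : W ⊕ B) (c : Fin 5)
    (g : Fin 5 × W × Fin 5 → GaugeGroup) :
    ∏ k, Γ.innerWeight f σ u k g ≤ D ^ 4 * Γ.innerWeight f σ u c g := by
  rw [← Finset.prod_erase_mul Finset.univ _ (Finset.mem_univ c)]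
  gcongr
  refine (Finset.prod_le_pow_card _ _ D fun k _ => hD _).trans_eq ?_
  simp

theorem measurable_prod_nodeWeight (Γ : ColoredGraph 5 W B) {f : GaugeGroup → ENNReal}
    (hf : Measurable f) (σ : Equiv.Perm (Fin 5)) (S : Finset (W ⊕ B)) :
    Measurable fun g => ∏ v ∈ S, Γ.nodeWeight f σ v g :=
  Finset.measurable_fun_prod _ fun v _ => Γ.measurable_nodeWeight hf σ v

variable [Fintype W]

/-- At a node joined to `S` by a line of color `σ c`, all the outer weights and one inner weight
can be integrated, except the outer weights of the faces that avoid `S`. -/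
theorem lintegral_mul_outerWeights_le (Γ : ColoredGraph 5 W B) {f : GaugeGroup → ENNReal}
    (hf : Measurable f) (hf1 : ∫⁻ h, f h ∂gaugeHaar = 1)
    (hcomm : ∀ a b, f (a * b) = f (b * a)) {D : ENNReal} (hD : ∀ a, f a ≤ D) (hD1 : 1 ≤ D)
    (σ : Equiv.Perm (Fin 5)) {S : Finset (W ⊕ B)} {u s : W ⊕ B} (hu : u ∉ S) (hs : s ∈ S)
    {c : Fin 5} (hc : (Γ.colorSubgraph {σ c}).Adj u s)
    {R : (Fin 5 × W × Fin 5 → GaugeGroup) → ENNReal} (hR : Measurable R)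
    (hloc : ∀ a b, Γ.IsLocalOff σ S u a b R) :
    ∫⁻ g, R g * Γ.innerWeight f σ u c g * ∏ k, Γ.outerWeight f σ u k g ∂lineMeasure W ≤
      D ^ Γ.numNewFaces σ S u * ∫⁻ g, R g ∂lineMeasure W := by
  classical
  have mo := Γ.measurable_outerWeight hf σ u
  have mi := Γ.measurable_innerWeight hf σ u
  set N := Finset.univ.filter fun k => ∀ s ∈ S, Γ.jacketFace σ k u ≠ Γ.jacketFace σ k s with hN
  have huS : u ∉ (S : Set (W ⊕ B)) := by simpa using hu
  have hsS : s ∈ (S : Set (W ⊕ B)) := by simpa using hs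
  have k1 : c - 1 + 1 = c := (by decide : ∀ c : Fin 5, c - 1 + 1 = c) c
  have k2 : c - 1 + 3 = c + 2 := (by decide : ∀ c : Fin 5, c - 1 + 3 = c + 2) c
  -- the weights that share the color of the line to `S`
  have hbase : ∫⁻ g, R g * Γ.innerWeight f σ u c g * Γ.outerWeight f σ u c g *
      Γ.outerWeight f σ u (c - 1) g ∂lineMeasure W = ∫⁻ g, R g ∂lineMeasure W := by
    -- The jacket pairs of the outer weights c - 1 and c also occur in the inner weight c. The
    -- non-jacket pairs (c, c + 2) and (c + 3, c) are used instead; every face containing color `σ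
    -- c` at u reaches S through the given line. The inner weight goes last, through (c, c + 1).
    have e1 : Γ.outerWeight f σ u (c - 1) =
        Γ.tripleWeight f u (σ c) (σ (c + 2)) (σ (c - 1)) := by
      rw [outerWeight, k1, k2, tripleWeight_rotate _ hcomm]
    have e2 : Γ.outerWeight f σ u c = Γ.tripleWeight f u (σ (c + 3)) (σ c) (σ (c + 1)) := by
      rw [outerWeight, ← tripleWeight_rotate _ hcomm]
    have e3 : Γ.innerWeight f σ u c = Γ.tripleWeight f u (σ c) (σ (c + 1)) (σ (c - 1)) := by
      rw [innerWeight, tripleWeight_rotate _ hcomm]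
    have d : ∀ c : Fin 5, (c ≠ c + 2 ∧ c ≠ c - 1 ∧ c + 2 ≠ c - 1) ∧
        (c + 3 ≠ c ∧ c + 3 ≠ c + 1 ∧ c ≠ c + 1) ∧ c + 1 ≠ c - 1 ∧
        c + 2 ≠ c + 1 ∧ c + 2 ≠ c + 3 ∧ c + 3 ≠ c - 1 := by decide
    obtain ⟨⟨d1, d2, d3⟩, ⟨d4, d5, d6⟩, d7, d8, d9, d10⟩ := d c
    have s1 := Γ.lintegral_mul_tripleWeight hf hf1 huS hsS d1 d2 d3
      (reachable_pair_of_adj hc (by simp)) ((hR.mul (mi c)).mul (mo c))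
      (((hloc _ _).mul (Γ.isLocalOff_tripleWeight f huS (Or.inr (Or.inr ⟨d3, d1.symm, d8⟩)))).mul
        (Γ.isLocalOff_tripleWeight f huS (Or.inr (Or.inr ⟨d1.symm, d8, d9⟩))))
    have s2 := Γ.lintegral_mul_tripleWeight hf hf1 huS hsS d4 d5 d6
      (reachable_pair_of_adj hc (by simp)) (hR.mul (mi c))
      ((hloc _ _).mul (Γ.isLocalOff_tripleWeight f huS (Or.inr (Or.inl ⟨d10, d4, d5⟩))))
    have s3 := Γ.lintegral_mul_tripleWeight hf hf1 huS hsS d6 d2 d7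
      (reachable_pair_of_adj hc (by simp)) hR (hloc _ _)
    rw [← e1] at s1
    rw [← e2] at s2
    rw [← e3] at s3
    exact s1.trans (s2.trans s3)
  -- the other outer weights
  have hK : ∀ K : Finset (Fin 5), c ∉ K → c - 1 ∉ K →
      ∫⁻ g, R g * Γ.innerWeight f σ u c g * Γ.outerWeight f σ u c g *
        Γ.outerWeight f σ u (c - 1) g * ∏ k ∈ K, Γ.outerWeight f σ u k g ∂lineMeasure W ≤
      D ^ (K ∩ N).card * ∫⁻ g, R g ∂lineMeasure W := by
    intro K
    induction K using Finset.induction_on with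
    | empty => intro _ _; simp [hbase]
    | insert k K hkK ih =>
      intro hcK hcK'
      rw [Finset.mem_insert, not_or] at hcK hcK'
      specialize ih hcK.2 hcK'.2
      simp only [Finset.prod_insert hkK, mul_comm (Γ.outerWeight f σ u k _), ← mul_assoc]
      have mF : Measurable fun g => R g * Γ.innerWeight f σ u c g * Γ.outerWeight f σ u c g *
          Γ.outerWeight f σ u (c - 1) g * ∏ k ∈ K, Γ.outerWeight f σ u k g :=
        (((hR.mul (mi c)).mul (mo c)).mul (mo _)).mul
          (Finset.measurable_fun_prod _ fun k _ => mo k)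
      by_cases hkN : k ∈ N
      · rw [Finset.insert_inter_of_mem hkN, Finset.card_insert_of_notMem (by simp [hkK]),
          pow_succ', mul_assoc]
        calc _ ≤ ∫⁻ g, D * (R g * Γ.innerWeight f σ u c g * Γ.outerWeight f σ u c g *
              Γ.outerWeight f σ u (c - 1) g * ∏ k ∈ K, Γ.outerWeight f σ u k g)
                ∂lineMeasure W := by
              refine lintegral_mono fun g => ?_
              dsimp only
              rw [mul_comm]
              exact mul_le_mul_left (hD _) _
          _ = D * _ := lintegral_const_mul _ mF
          _ ≤ _ := mul_le_mul_right ih _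
      · rw [Finset.insert_inter_of_notMem hkN]
        refine le_of_eq_of_le ?_ ih
        obtain ⟨s', hs', hface⟩ : ∃ s' ∈ S, Γ.jacketFace σ k u = Γ.jacketFace σ k s' := by
          by_contra! h
          exact hkN (Finset.mem_filter.mpr ⟨Finset.mem_univ _, h⟩)
        have hr := SimpleGraph.ConnectedComponent.exact hface
        -- The pair (k, k + 1) lies in the inner triple of c only for k = c and k = c - 1, and in no
        -- outer triple but its own (`d'`).
        have d : ∀ k c : Fin 5, c ≠ k → c - 1 ≠ k →
            (k ≠ c - 1 ∧ k ≠ c ∧ k ≠ c + 1) ∨ (k + 1 ≠ c - 1 ∧ k + 1 ≠ c ∧ k + 1 ≠ c + 1) := by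
          decide
        have d₀ : ∀ k : Fin 5, k ≠ k + 1 ∧ k ≠ k + 3 ∧ k + 1 ≠ k + 3 := by decide
        have d' : ∀ k c : Fin 5, c ≠ k →
            (k ≠ c ∧ k ≠ c + 1 ∧ k ≠ c + 3) ∨ (k + 1 ≠ c ∧ k + 1 ≠ c + 1 ∧ k + 1 ≠ c + 3) := by
          decide
        have lo : ∀ k', k' ≠ k → Γ.IsLocalOff σ S u k (k + 1) (Γ.outerWeight f σ u k') :=
          fun k' hk' => Γ.isLocalOff_tripleWeight f huS (Or.inr (d' k k' hk'))
        exact Γ.lintegral_mul_tripleWeight hf hf1 huS (by simpa using hs') (d₀ k).1 (d₀ k).2.1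
          (d₀ k).2.2 hr mF
          (((((hloc _ _).mul (Γ.isLocalOff_tripleWeight f huS
            (Or.inr (d k c hcK.1 hcK'.1)))).mul (lo c hcK.1)).mul (lo _ hcK'.1)).mul
            (IsLocalOff.prod fun k' hk' => lo k' fun h => hkK (h ▸ hk')))
  have hfin := hK ((Finset.univ.erase c).erase (c - 1)) (by simp) (by simp)
  have hc1 : c - 1 ∈ (Finset.univ : Finset (Fin 5)).erase c := by
    simp only [Finset.mem_erase, Finset.mem_univ, and_true]
    exact (by decide : ∀ c : Fin 5, c - 1 ≠ c) c
  calc _ = ∫⁻ g, R g * Γ.innerWeight f σ u c g * Γ.outerWeight f σ u c g *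
        Γ.outerWeight f σ u (c - 1) g *
          ∏ k ∈ (Finset.univ.erase c).erase (c - 1), Γ.outerWeight f σ u k g ∂lineMeasure W := by
        refine lintegral_congr fun g => ?_
        rw [← Finset.mul_prod_erase Finset.univ _ (Finset.mem_univ c),
          ← Finset.mul_prod_erase _ _ hc1]
        simp only [mul_assoc]
    _ ≤ _ := hfin
    _ ≤ _ := by
        gcongr
        exact Finset.card_le_card Finset.inter_subset_right

variable [Fintype B] [DecidableEq (W ⊕ B)]

/-- The integral of the weights at the nodes outside `S`. -/
noncomputable def partialIntegral (Γ : ColoredGraph 5 W B) (f : GaugeGroup → ENNReal)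
    (σ : Equiv.Perm (Fin 5)) (S : Finset (W ⊕ B)) : ENNReal :=
  ∫⁻ g, ∏ v ∈ Sᶜ, Γ.nodeWeight f σ v g ∂lineMeasure W

theorem partialIntegral_le_insert (Γ : ColoredGraph 5 W B) {f : GaugeGroup → ENNReal}
    (hf : Measurable f) (hf1 : ∫⁻ h, f h ∂gaugeHaar = 1)
    (hcomm : ∀ a b, f (a * b) = f (b * a)) {D : ENNReal} (hD : ∀ a, f a ≤ D) (hD1 : 1 ≤ D)
    (σ : Equiv.Perm (Fin 5)) {S : Finset (W ⊕ B)} {u s : W ⊕ B} (hu : u ∉ S) (hs : s ∈ S)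
    {c : Fin 5} (hc : (Γ.colorSubgraph {σ c}).Adj u s) :
    Γ.partialIntegral f σ S ≤
      D ^ (4 + Γ.numNewFaces σ S u) * Γ.partialIntegral f σ (insert u S) := by
  have hcompl : Sᶜ = insert u (insert u S)ᶜ := by
    rw [Finset.compl_insert, Finset.insert_erase (by simpa using hu)]
  set R := fun g => ∏ v ∈ (insert u S)ᶜ, Γ.nodeWeight f σ v g with hRdef
  have hR : Measurable R := Γ.measurable_prod_nodeWeight hf σ _
  have hloc : ∀ a b, Γ.IsLocalOff σ S u a b R := fun a b => IsLocalOff.prod fun v hv => by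
    rw [Finset.mem_compl, Finset.mem_insert, not_or] at hv
    have hvS : v ∉ (S : Set (W ⊕ B)) := by simpa using hv.2
    exact (IsLocalOff.prod fun k _ => Γ.isLocalOff_tripleWeight f hvS (Or.inl hv.1)).mul
      (IsLocalOff.prod fun k _ => Γ.isLocalOff_tripleWeight f hvS (Or.inl hv.1))
  have hmain := Γ.lintegral_mul_outerWeights_le hf hf1 hcomm hD hD1 σ hu hs hc hR hloc
  have mG : Measurable fun g => R g * Γ.innerWeight f σ u c g * ∏ k, Γ.outerWeight f σ u k g :=
    (hR.mul (Γ.measurable_innerWeight hf σ u c)).mul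
      (Finset.measurable_fun_prod _ fun k _ => Γ.measurable_outerWeight hf σ u k)
  rw [pow_add, mul_assoc]
  calc Γ.partialIntegral f σ S
      ≤ ∫⁻ g, D ^ 4 * (R g * Γ.innerWeight f σ u c g * ∏ k, Γ.outerWeight f σ u k g)
          ∂lineMeasure W := by
        refine lintegral_mono fun g => ?_
        rw [hcompl, Finset.prod_insert (by simp), nodeWeight]
        calc _ ≤ (∏ k, Γ.outerWeight f σ u k g) * (D ^ 4 * Γ.innerWeight f σ u c g) * R g := by
              gcongr
              exact Γ.prod_innerWeight_le hD σ u c g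
          _ = _ := by ring
    _ = D ^ 4 * _ := lintegral_const_mul _ mG
    _ ≤ _ := by gcongr; exact hmain

/-! ### Counting the jacket faces while the nodes are eliminated -/

open Classical in
/-- The number of faces of the jacket that avoid `S`. -/
noncomputable def numFacesOff (Γ : ColoredGraph 5 W B) (σ : Equiv.Perm (Fin 5))
    (S : Finset (W ⊕ B)) : ℕ :=
  ∑ k, (Finset.univ.filter fun F : Γ.Face {σ k, σ (k + 1)} =>
    ∀ s ∈ S, F ≠ Γ.jacketFace σ k s).card

theorem numFacesOff_insert (Γ : ColoredGraph 5 W B) (σ : Equiv.Perm (Fin 5))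
    (S : Finset (W ⊕ B)) (u : W ⊕ B) :
    Γ.numFacesOff σ S = Γ.numNewFaces σ S u + Γ.numFacesOff σ (insert u S) := by
  classical
  rw [numFacesOff, numFacesOff, numNewFaces, Finset.card_filter, ← Finset.sum_add_distrib]
  refine Finset.sum_congr rfl fun k _ => ?_
  have hset : (Finset.univ.filter fun F : Γ.Face {σ k, σ (k + 1)} =>
      ∀ s ∈ insert u S, F ≠ Γ.jacketFace σ k s) =
      (Finset.univ.filter fun F : Γ.Face {σ k, σ (k + 1)} =>
        ∀ s ∈ S, F ≠ Γ.jacketFace σ k s).erase (Γ.jacketFace σ k u) := by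
    ext F
    simp only [Finset.mem_filter, Finset.mem_univ, true_and, Finset.mem_erase,
      Finset.forall_mem_insert]
  rw [hset]
  split_ifs with h
  · rw [add_comm 1, Finset.card_erase_add_one (by simpa using h)]
  · rw [Finset.erase_eq_of_notMem (by simpa using h), zero_add]

theorem exists_adj_of_isConnected {Γ : ColoredGraph 5 W B} (hΓ : Γ.IsConnected)
    (σ : Equiv.Perm (Fin 5)) {S : Finset (W ⊕ B)} (hS : S.Nonempty) (hS' : S ≠ Finset.univ) :
    ∃ u ∉ S, ∃ s ∈ S, ∃ c, (Γ.colorSubgraph {σ c}).Adj u s := by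
  obtain ⟨s₀, hs₀⟩ := hS
  obtain ⟨u₀, hu₀⟩ : ∃ u, u ∉ S := by
    by_contra! h
    exact hS' (Finset.eq_univ_iff_forall.mpr h)
  obtain ⟨walk⟩ := hΓ.preconnected u₀ s₀
  obtain ⟨d, -, hd1, hd2⟩ := walk.exists_boundary_dart (S : Set (W ⊕ B))ᶜ (by simpa using hu₀)
    (by simpa using hs₀)
  obtain ⟨ℓ, -, w, hw⟩ := exists_line_of_adj d.adj
  refine ⟨d.fst, by simpa using hd1, d.snd, by simpa using hd2, σ.symm ℓ, ?_⟩
  rw [Equiv.apply_symm_apply]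
  exact adj_of_line (Finset.mem_singleton_self _) hw

theorem partialIntegral_le (Γ : ColoredGraph 5 W B) (hΓ : Γ.IsConnected)
    {f : GaugeGroup → ENNReal} (hf : Measurable f) (hf1 : ∫⁻ h, f h ∂gaugeHaar = 1)
    (hcomm : ∀ a b, f (a * b) = f (b * a)) {D : ENNReal} (hD : ∀ a, f a ≤ D) (hD1 : 1 ≤ D)
    (σ : Equiv.Perm (Fin 5)) (m : ℕ) : ∀ S : Finset (W ⊕ B), S.Nonempty → Sᶜ.card = m →
      Γ.partialIntegral f σ S ≤ D ^ (4 * m + Γ.numFacesOff σ S) := by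
  induction m with
  | zero =>
    intro S _ hcard
    rw [Finset.card_eq_zero] at hcard
    simp only [partialIntegral, hcard, Finset.prod_empty, lintegral_one, measure_univ]
    exact one_le_pow₀ hD1
  | succ m ih =>
    intro S hS hcard
    obtain ⟨u, hu, s, hs, c, hc⟩ := exists_adj_of_isConnected hΓ σ hS (by
      rintro rfl; simp at hcard)
    refine (Γ.partialIntegral_le_insert hf hf1 hcomm hD hD1 σ hu hs hc).trans ?_
    have hcard' : (insert u S)ᶜ.card = m := by
      rw [Finset.compl_insert, Finset.card_erase_of_mem (by simpa using hu), hcard]; rfl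
    calc _ ≤ D ^ (4 + Γ.numNewFaces σ S u) * D ^ (4 * m + Γ.numFacesOff σ (insert u S)) := by
          gcongr
          exact ih _ (Finset.insert_nonempty u S) hcard'
      _ = _ := by
          rw [← pow_add, Γ.numFacesOff_insert σ S u]
          congr 1
          ring

/-- The integral of all the weights: each face of the jacket counts once. -/
theorem lintegral_prod_nodeWeight_le (Γ : ColoredGraph 5 W B) (hΓ : Γ.IsConnected)
    {f : GaugeGroup → ENNReal} (hf : Measurable f) (hf1 : ∫⁻ h, f h ∂gaugeHaar = 1)
    (hcomm : ∀ a b, f (a * b) = f (b * a)) {D : ENNReal} (hD : ∀ a, f a ≤ D) (hD1 : 1 ≤ D)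
    (σ : Equiv.Perm (Fin 5)) :
    ∫⁻ g, ∏ v, Γ.nodeWeight f σ v g ∂lineMeasure W ≤
      D ^ (4 * Γ.order + 1 + ∑ k, Nat.card (Γ.Face {σ k, σ (k + 1)})) := by
  obtain ⟨v₀⟩ := hΓ.nonempty
  have hcard : ({v₀} : Finset (W ⊕ B))ᶜ.card + 1 = Γ.order := by
    have := Finset.card_compl_add_card ({v₀} : Finset (W ⊕ B))
    rwa [Finset.card_singleton] at this
  -- No node has been eliminated before the root, so its ten weights are all bounded by D.
  have h1 : ∫⁻ g, ∏ v, Γ.nodeWeight f σ v g ∂lineMeasure W ≤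
      D ^ 10 * Γ.partialIntegral f σ {v₀} := by
    rw [partialIntegral, ← lintegral_const_mul _ (Γ.measurable_prod_nodeWeight hf σ _)]
    refine lintegral_mono fun g => ?_
    dsimp only
    rw [← Finset.mul_prod_erase Finset.univ _ (Finset.mem_univ v₀), Finset.compl_singleton]
    gcongr
    calc Γ.nodeWeight f σ v₀ g ≤ D ^ 5 * D ^ 5 := by
          rw [nodeWeight]
          gcongr
          · exact (Finset.prod_le_pow_card _ _ D fun k _ => hD _).trans_eq (by simp)
          · exact (Finset.prod_le_pow_card _ _ D fun k _ => hD _).trans_eq (by simp)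
      _ = D ^ 10 := by rw [← pow_add]
  have h2 := Γ.partialIntegral_le hΓ hf hf1 hcomm hD hD1 σ _ {v₀} (by simp) rfl
  -- The root lies on one face of each of the five jacket pairs, and these are never paid for again.
  have h3 : Γ.numFacesOff σ {v₀} + 5 = ∑ k, Nat.card (Γ.Face {σ k, σ (k + 1)}) := by
    classical
    have e0 : Γ.numFacesOff σ ∅ = ∑ k, Nat.card (Γ.Face {σ k, σ (k + 1)}) := by
      simp [numFacesOff, Nat.card_eq_fintype_card]
    have e1 : Γ.numNewFaces σ ∅ v₀ = 5 := by simp [numNewFaces]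
    rw [← e0, Γ.numFacesOff_insert σ ∅ v₀, e1, add_comm]
    rfl
  calc _ ≤ D ^ 10 * D ^ (4 * ({v₀} : Finset (W ⊕ B))ᶜ.card + Γ.numFacesOff σ {v₀}) :=
        h1.trans (by gcongr)
    _ = _ := by
        rw [← pow_add]
        congr 1
        omega

end ColoredGraph

/-! ## The ten triples of colors -/

/-- The increasing triples of colors. -/
def increasingTriples : Finset (Fin 5 × Fin 5 × Fin 5) :=
  Finset.univ.filter fun t => t.1 < t.2.1 ∧ t.2.1 < t.2.2

/-- The increasing rearrangement of a triple of distinct colors. -/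
def sortTriple (t : Fin 5 × Fin 5 × Fin 5) : Fin 5 × Fin 5 × Fin 5 :=
  if t.1 < t.2.1 then
    if t.2.1 < t.2.2 then t
    else if t.1 < t.2.2 then (t.1, t.2.2, t.2.1) else (t.2.2, t.1, t.2.1)
  else
    if t.1 < t.2.2 then (t.2.1, t.1, t.2.2)
    else if t.2.1 < t.2.2 then (t.2.1, t.2.2, t.1) else (t.2.2, t.2.1, t.1)

theorem sortTriple_mem : ∀ i j k : Fin 5, i ≠ j → j ≠ k → i ≠ k →
    sortTriple (i, j, k) ∈ increasingTriples := by
  decide +kernel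

theorem toFinset_sortTriple (t : Fin 5 × Fin 5 × Fin 5) :
    ({(sortTriple t).1, (sortTriple t).2.1, (sortTriple t).2.2} : Finset (Fin 5)) =
      {t.1, t.2.1, t.2.2} := by
  unfold sortTriple
  ext x
  split_ifs <;> simp only [Finset.mem_insert, Finset.mem_singleton] <;> tauto

theorem increasingTriples_ext : ∀ t ∈ increasingTriples, ∀ t' ∈ increasingTriples,
    ({t.1, t.2.1, t.2.2} : Finset (Fin 5)) = {t'.1, t'.2.1, t'.2.2} → t = t' := by
  decide +kernel

/-- Rotation and reversal generate all permutations of three arguments, so `Φ` depends only on the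
set of colors, and `σ` permutes the ten sets. -/
theorem prod_increasingTriples_perm {M : Type*} [CommMonoid M] {Φ : Fin 5 → Fin 5 → Fin 5 → M}
    (hrot : ∀ i j k, Φ i j k = Φ j k i) (hrev : ∀ i j k, Φ i j k = Φ i k j)
    (σ : Equiv.Perm (Fin 5)) :
    ∏ t ∈ increasingTriples, Φ (σ t.1) (σ t.2.1) (σ t.2.2) =
      ∏ t ∈ increasingTriples, Φ t.1 t.2.1 t.2.2 := by
  have hmaps : ∀ t ∈ increasingTriples,
      sortTriple (σ t.1, σ t.2.1, σ t.2.2) ∈ increasingTriples := fun t ht => by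
    obtain ⟨-, h1, h2⟩ := Finset.mem_filter.mp ht
    exact sortTriple_mem _ _ _ (σ.injective.ne h1.ne) (σ.injective.ne h2.ne)
      (σ.injective.ne (h1.trans h2).ne)
  have hinj : Set.InjOn (fun t : Fin 5 × Fin 5 × Fin 5 => sortTriple (σ t.1, σ t.2.1, σ t.2.2))
      increasingTriples := fun t ht t' ht' h => by
    dsimp only at h
    refine increasingTriples_ext t ht t' ht' (Finset.image_injective σ.injective ?_)
    have := toFinset_sortTriple (σ t.1, σ t.2.1, σ t.2.2)
    rw [h, toFinset_sortTriple] at this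
    simpa only [Finset.image_insert, Finset.image_singleton] using this.symm
  refine Finset.prod_nbij (fun t => sortTriple (σ t.1, σ t.2.1, σ t.2.2)) hmaps hinj
    (Finset.surjOn_of_injOn_of_card_le _ hmaps hinj le_rfl) fun t _ => ?_
  generalize σ t.1 = i
  generalize σ t.2.1 = j
  generalize σ t.2.2 = k
  unfold sortTriple
  split_ifs
  · rfl
  · exact hrev i j k
  · exact (hrot k i j).symm
  · exact (hrev i j k).trans ((hrot j i k).symm ▸ rfl)
  · exact hrot i j k
  · exact ((hrot k j i).trans ((hrot j i k).trans (hrev i k j))).symm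

theorem increasingTriples_eq : increasingTriples =
    {(0, 1, 2), (0, 1, 3), (0, 1, 4), (0, 2, 3), (0, 2, 4), (0, 3, 4), (1, 2, 3), (1, 2, 4),
      (1, 3, 4), (2, 3, 4)} := by
  decide

/-- Three vertices of a pentagon are either consecutive or an edge {k, k + 1} with its opposite
vertex k + 3. -/
theorem prod_increasingTriples {M : Type*} [CommMonoid M] {Φ : Fin 5 → Fin 5 → Fin 5 → M}
    (hrot : ∀ i j k, Φ i j k = Φ j k i) :
    ∏ t ∈ increasingTriples, Φ t.1 t.2.1 t.2.2 =
      (∏ k : Fin 5, Φ k (k + 1) (k + 3)) * ∏ k : Fin 5, Φ (k - 1) k (k + 1) := by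
  rw [increasingTriples_eq, Fin.prod_univ_five, Fin.prod_univ_five]
  have e1 : ∏ t ∈ ({(0, 1, 2), (0, 1, 3), (0, 1, 4), (0, 2, 3), (0, 2, 4), (0, 3, 4), (1, 2, 3),
      (1, 2, 4), (1, 3, 4), (2, 3, 4)} : Finset (Fin 5 × Fin 5 × Fin 5)), Φ t.1 t.2.1 t.2.2 =
      Φ 0 1 2 * (Φ 0 1 3 * (Φ 0 1 4 * (Φ 0 2 3 * (Φ 0 2 4 * (Φ 0 3 4 * (Φ 1 2 3 * (Φ 1 2 4 *
        (Φ 1 3 4 * Φ 2 3 4)))))))) := by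
    repeat rw [Finset.prod_insert (by decide)]
    rw [Finset.prod_singleton]
  rw [e1]
  change _ = Φ 0 1 3 * Φ 1 2 4 * Φ 2 3 0 * Φ 3 4 1 * Φ 4 0 2 *
    (Φ 4 0 1 * Φ 0 1 2 * Φ 1 2 3 * Φ 2 3 4 * Φ 3 4 0)
  rw [hrot 2 3 0, hrot 3 0 2, hrot 3 4 1, hrot 4 1 3, hrot 4 0 2, hrot 4 0 1, hrot 3 4 0,
    hrot 4 0 3]
  ac_rfl

/-! ### The bound on the amplitude -/

namespace ColoredGraph

variable {W B : Type*}

theorem enorm_finsetProd {ι : Type*} (s : Finset ι) (φ : ι → ℝ) :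
    ‖∏ i ∈ s, φ i‖ₑ = ∏ i ∈ s, ‖φ i‖ₑ := by
  simp only [enorm_eq_nnnorm, nnnorm_prod, ENNReal.ofNNReal_finsetProd]

theorem enorm_interactionKernel (Γ : ColoredGraph 5 W B) (Z : Subgroup (ℤˣ × ℤˣ)) {α : ℝ}
    (hα : 0 < α) (σ : Equiv.Perm (Fin 5)) (v : W ⊕ B) (g : Fin 5 × W × Fin 5 → GaugeGroup) :
    ‖interactionKernel Z α fun ℓ i => g (ℓ, Γ.whiteEnd ℓ v, i)‖ₑ =
      (ENNReal.ofReal (deltaRegOne α) ^ 4)⁻¹ *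
        Γ.nodeWeight (fun a => ‖deltaRegMod Z α a‖ₑ) σ v g := by
  have hpos := deltaRegOne_pos hα
  have hcomm : ∀ a b, ‖deltaRegMod Z α (a * b)‖ₑ = ‖deltaRegMod Z α (b * a)‖ₑ := fun a b => by
    rw [deltaRegMod_mul_comm]
  have hinv : ∀ a, ‖deltaRegMod Z α a⁻¹‖ₑ = ‖deltaRegMod Z α a‖ₑ := fun a => by
    rw [deltaRegMod_inv]
  set f := fun a => ‖deltaRegMod Z α a‖ₑ with hf
  set Φ : Fin 5 → Fin 5 → Fin 5 → ENNReal := fun i j k => Γ.tripleWeight f v i j k g with hΦ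
  have hrot : ∀ i j k, Φ i j k = Φ j k i := fun i j k =>
    congrFun (Γ.tripleWeight_rotate (f := f) hcomm v i j k) g
  have hrev : ∀ i j k, Φ i j k = Φ i k j := fun i j k =>
    congrFun (Γ.tripleWeight_reverse (f := f) hinv v i j k) g
  have hprod : ‖∏ t ∈ increasingTriples, deltaRegMod Z α
      (holonomy (fun ℓ i => g (ℓ, Γ.whiteEnd ℓ v, i)) t.1 t.2.1 t.2.2)‖ₑ =
        ∏ t ∈ increasingTriples, Φ t.1 t.2.1 t.2.2 := by
    rw [enorm_finsetProd]
    refine Finset.prod_congr rfl fun t _ => ?_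
    refine (Γ.holonomy_weight (f := f) hcomm v t.1 t.2.1 t.2.2 g).trans ?_
    exact (hrot t.2.1 t.1 t.2.2).trans (hrev t.1 t.2.2 t.2.1)
  rw [interactionKernel, enorm_mul, ← increasingTriples, hprod,
    ← prod_increasingTriples_perm hrot hrev σ,
    prod_increasingTriples (Φ := fun i j k => Φ (σ i) (σ j) (σ k)) fun i j k => hrot _ _ _]
  congr 1
  rw [enorm_inv (by positivity), enorm_pow, Real.enorm_of_nonneg hpos.le]

theorem one_le_deltaRegOne {α : ℝ} (hα : 0 < α) : 1 ≤ deltaRegOne α := by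
  have : 1 ≤ heatKernel α 1 := by
    rw [heatKernel_one]
    refine le_trans (by simp [heatWeight]) ((summable_heatWeight_mul hα).le_tsum 0
      fun m _ => mul_nonneg (heatWeight_nonneg α m) (by positivity))
  rw [deltaRegOne_eq]
  nlinarith

variable [Fintype W] [Fintype B]

theorem abs_amplitude_le (Γ : ColoredGraph 5 W B) (hΓ : Γ.IsConnected) (Z : Subgroup (ℤˣ × ℤˣ))
    (σ : Equiv.Perm (Fin 5)) {α : ℝ} (hα : 0 < α) :
    |Γ.amplitude Z α| ≤
      deltaRegOne α ^ (1 + ∑ k, Nat.card (Γ.Face {σ k, σ (k + 1)})) := by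
  classical
  have hpos := deltaRegOne_pos hα
  set D := ENNReal.ofReal (deltaRegOne α) with hDdef
  have hD0 : D ≠ 0 := (ENNReal.ofReal_pos.mpr hpos).ne'
  have hDt : D ≠ ⊤ := ENNReal.ofReal_ne_top
  set f := fun a => ‖deltaRegMod Z α a‖ₑ with hfdef
  have hf : Measurable f := (continuous_deltaRegMod Z hα).measurable.enorm
  have hD : ∀ a, f a ≤ D := fun a => by
    simp only [hfdef, Real.enorm_of_nonneg (deltaRegMod_nonneg Z hα a)]
    exact ENNReal.ofReal_le_ofReal (deltaRegMod_le Z hα a)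
  have hD1 : 1 ≤ D := by
    rw [hDdef, ← ENNReal.ofReal_one]; exact ENNReal.ofReal_le_ofReal (one_le_deltaRegOne hα)
  have hbound := Γ.lintegral_prod_nodeWeight_le hΓ hf (lintegral_enorm_deltaRegMod Z hα)
    (fun a b => by simp only [hfdef, deltaRegMod_mul_comm Z α a b]) hD hD1 σ
  have hint : ∀ g, ‖Γ.amplitudeIntegrand Z α g‖ₑ =
      (D ^ (4 * Γ.order))⁻¹ * ∏ v, Γ.nodeWeight f σ v g := fun g => by
    have h1 : Γ.amplitudeIntegrand Z α g =
        ∏ v : W ⊕ B, interactionKernel Z α fun ℓ i => g (ℓ, Γ.whiteEnd ℓ v, i) := by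
      rw [Fintype.prod_sum_type]; rfl
    rw [h1, enorm_finsetProd]
    simp only [Γ.enorm_interactionKernel Z hα σ]
    rw [Finset.prod_mul_distrib, Finset.prod_const, Finset.card_univ, ← ENNReal.inv_pow, ← pow_mul]
    rfl
  have hA : ‖Γ.amplitude Z α‖ₑ ≤ D ^ (1 + ∑ k, Nat.card (Γ.Face {σ k, σ (k + 1)})) := by
    refine (enorm_integral_le_lintegral_enorm _).trans ?_
    simp only [hint]
    change ∫⁻ g, _ ∂lineMeasure W ≤ _
    rw [lintegral_const_mul' _ _ (ENNReal.inv_ne_top.mpr (pow_ne_zero _ hD0))]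
    refine (mul_le_mul_right hbound _).trans ?_
    rw [add_assoc, pow_add, ← mul_assoc,
      ENNReal.inv_mul_cancel (pow_ne_zero _ hD0) (ENNReal.pow_ne_top hDt), one_mul]
  rw [hDdef, ← ENNReal.ofReal_pow hpos.le, Real.enorm_eq_ofReal_abs] at hA
  exact (ENNReal.ofReal_le_ofReal_iff (by positivity)).mp hA

/-! ## The divergence degree -/

/-- Every γ above the threshold is admissible with limit 0, because `deltaRegOne` tends to infinity.
-/
theorem divergenceDegree_le_of_abs_amplitude_le (Γ : ColoredGraph 5 W B) (Z : Subgroup (ℤˣ × ℤˣ))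
    {m : ℕ} (h : ∀ α > 0, |Γ.amplitude Z α| ≤ deltaRegOne α ^ m) :
    Γ.divergenceDegree Z ≤ ((m - 3 / 2 * Γ.order : ℝ) : EReal) := by
  refine EReal.le_of_forall_lt_iff_le.mp fun γ hγ => sInf_le ⟨γ, rfl, 0, ?_⟩
  have hγ' : (m - 3 / 2 * Γ.order : ℝ) < γ := by exact_mod_cast hγ
  have hlim := (tendsto_rpow_neg_atTop (sub_pos.mpr hγ')).comp tendsto_deltaRegOne
  refine squeeze_zero_norm' ?_ hlim
  filter_upwards [self_mem_nhdsWithin] with α hα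
  have hpos := deltaRegOne_pos hα
  rw [rescaledAmplitude, ← mul_assoc, ← Real.rpow_add hpos, norm_mul,
    Real.norm_of_nonneg (Real.rpow_nonneg hpos.le _), Real.norm_eq_abs]
  calc _ ≤ deltaRegOne α ^ (-γ + -(3 / 2 : ℝ) * Γ.order) * deltaRegOne α ^ m := by
        gcongr
        exact h α hα
    _ = _ := by
        rw [← Real.rpow_natCast, ← Real.rpow_add hpos]
        simp only [Function.comp]
        congr 1
        ring

theorem sum_jacket {M : Type*} [AddCommMonoid M] (σ : Equiv.Perm (Fin 5))
    (φ : Finset (Fin 5) → M) :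
    ∑ p ∈ Finset.univ.image (fun ℓ : Fin 5 => ({σ ℓ, σ (ℓ + 1)} : Finset (Fin 5))), φ p =
      ∑ k, φ {σ k, σ (k + 1)} := by
  refine Finset.sum_image fun k _ l _ h => ?_
  have hinj : ∀ k l : Fin 5, ({k, k + 1} : Finset (Fin 5)) = {l, l + 1} → k = l := by decide
  refine hinj k l (Finset.image_injective σ.injective ?_)
  simpa only [Finset.image_insert, Finset.image_singleton] using h

theorem divergenceDegree_le_jacketGenus (Γ : ColoredGraph 5 W B) (hΓ : Γ.IsConnected)
    (Z : Subgroup (ℤˣ × ℤˣ)) {J : Finset (Finset (Fin 5))} (hJ : J ∈ jackets) :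
    Γ.divergenceDegree Z ≤ ((3 - 2 * Γ.jacketGenus J : ℝ) : EReal) := by
  obtain ⟨σ, -, rfl⟩ := Finset.mem_image.mp hJ
  refine (Γ.divergenceDegree_le_of_abs_amplitude_le Z
    fun α hα => Γ.abs_amplitude_le hΓ Z σ hα).trans_eq ?_
  -- The lines of one color match white and black nodes, so the number of lines is 5/2 of the order.
  have hBW : (Fintype.card B : ℝ) = Fintype.card W := by
    rw [Fintype.card_congr (Γ.line 0)]
  rw [jacketGenus, jacketEulerChar, sum_jacket σ fun p => (Nat.card (Γ.Face p) : ℤ)]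
  congr 1
  simp only [order, numLines, Fintype.card_sum, Fintype.card_prod, Fintype.card_fin]
  push_cast
  rw [hBW]
  ring

end ColoredGraph

theorem card_jackets : jackets.card = 12 := by
  decide +kernel

theorem mainTheorem10 {W B : Type*} [Fintype W] [Fintype B] (Γ : ColoredGraph 5 W B)
    (hΓ : Γ.IsConnected) (Z : Subgroup (ℤˣ × ℤˣ)) :
    (∀ J ∈ jackets, Γ.divergenceDegree Z ≤ ((3 - 2 * Γ.jacketGenus J : ℝ) : EReal)) ∧
      Γ.divergenceDegree Z ≤ ((3 - Γ.degree / 6 : ℝ) : EReal) := by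
  have h := fun J hJ => Γ.divergenceDegree_le_jacketGenus hΓ Z (J := J) hJ
  refine ⟨h, ?_⟩
  have hne : jackets.Nonempty := by rw [← Finset.card_pos, card_jackets]; norm_num
  -- Some jacket has at least the average genus, the degree divided by 12.
  obtain ⟨J, hJ, hle⟩ := Finset.exists_le_of_sum_le hne
    (f := fun _ => Γ.degree / 12) (g := Γ.jacketGenus) (by
      rw [Finset.sum_const, card_jackets, ColoredGraph.degree, nsmul_eq_mul]
      push_cast
      linarith)
  refine (h J hJ).trans (EReal.coe_le_coe_iff.mpr ?_)
  linarith
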